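/- Let $\mathbb T$ be either $[0,T]$ with $T>0$ or $[0,\infty)$, and let $\omega$ be a control on $\mathbb T$: $\omega_{s,t}\ge 0$ for $s\le t$ in $\mathbb T$, $\omega_{s,s}=0$, $\omega_{r,s}+\omega_{s,t}\le\omega_{r,t}$ for $r\le s\le t$, and for every $\delta>0$ there is $\varepsilon>0$ such that $\omega_{s,t}<\delta$ whenever $s\le t\le s+\varepsilon$. Let $U$ be a Banach space and let $V$ be a finite-dimensional real normed space. Equip $U\otimes U$ with a norm such that $|u\otimes v|\le|u|\,|v|$ for all $u,v\in U$, and such that $|(\alpha\otimes\beta)(z)|\le C|\alpha|\,|\beta|\,|z|$ for all continuous linear forms $\alpha,\beta$ on $U$ and all $z\in U\otimes U$, with a constant $C$ (this second condition is automatic when $\dim U<\infty$); let $U\hat\otimes U$ be the completion. Let $2\le p<3$ and let $\mathbf x=(1,\mathbf x^1,\mathbf x^2)$ be a level-2 rough path of finite $p$-variation controlled by $\omega$, that is, $\mathbf x^1_{s,t}\in U$ and $\mathbf x^2_{s,t}\in U\hat\otimes U$ for $s\le t$ in $\mathbb T$ satisfy $$\mathbf x^1_{r,t}=\mathbf x^1_{r,s}+\mathbf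 x^1_{s,t},\qquad \mathbf x^2_{r,t}=\mathbf x^2_{r,s}+\mathbf x^2_{s,t}+\mathbf x^1_{r,s}\otimes\mathbf x^1_{s,t}\qquad(r\le s\le t),$$ and $|\mathbf x^1_{s,t}|\le C\omega_{s,t}^{1/p}$, $|\mathbf x^2_{s,t}|\le C\omega_{s,t}^{2/p}$ for a constant $C$. Let $f\in\mathcal C^2_{\mathrm b}(V,\mathcal L(U,V))$, meaning that $f$ is bounded and differentiable, with bounded and Lipschitz continuous derivative $\mathrm df$. For $s\le t$ in $\mathbb T$ and $a\in V$ put $$\phi_{t,s}(a)=a+f(a)\mathbf x^1_{s,t}+\mathrm df(a)\cdot f(a)\,\mathbf x^2_{s,t},$$ where $\mathrm df(a)\cdot f(a)$ is the continuous linear map $U\hat\otimes U\to V$ with $u\otimes v\mapsto \big(\mathrm df(a)(f(a)u)\big)v$. Then there exists a flow $\psi$ in the same galaxy as $\phi$ such that every $\psi_{t,s}$ is Borel measurable. That is, there are maps $\psi_{t,s}:V\to V$, $s\le t$ in $\mathbb T$, such that: - $\psi_{t,t}(a)=a$ and $\psi_{t,s}(\psi_{s,r}(a))=\psi_{t,r}(a)$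 for all $a\in V$ and $r\le s\le t$ in $\mathbb T$; - for all $s\in\mathbb T$ and $a\in V$, the path $t\mapsto\psi_{t,s}(a)$ is continuous on $\mathbb T\cap[s,\infty)$; - there is a constant $C$ with $|\phi_{t,s}(a)-\psi_{t,s}(a)|\le C\,\omega_{s,t}^{3/p}$ for all $a\in V$ and $s\le t$ in $\mathbb T$; - $\psi_{t,s}$ is Borel measurable for all $s\le t$ in $\mathbb T$. (No uniqueness of the solutions of the rough differential equation $\mathrm dy=f(y)\,\mathrm d\mathbf x$ is assumed.) -/

import Mathlib

open scoped TensorProduct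

noncomputable section

/-! ### Time sets and controls -/

/-- The time set is either a compact interval `[0, T]` with `T > 0`, or `[0, ∞)`. -/
def IsTimeSet (𝕋 : Set ℝ) : Prop :=
  (∃ T : ℝ, 0 < T ∧ 𝕋 = Set.Icc 0 T) ∨ 𝕋 = Set.Ici 0

/-- `ω` (used only at pairs `s ≤ t` of points of `𝕋`) is a control: nonnegative, zero on the
diagonal, super-additive, and small uniformly near the diagonal. -/
structure IsControl (𝕋 : Set ℝ) (ω : ℝ → ℝ → ℝ) : Prop where
  nonneg : ∀ s ∈ 𝕋, ∀ t ∈ 𝕋, s ≤ t → 0 ≤ ω s t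
  diag : ∀ s ∈ 𝕋, ω s s = 0
  superadd : ∀ r ∈ 𝕋, ∀ s ∈ 𝕋, ∀ t ∈ 𝕋, r ≤ s → s ≤ t → ω r s + ω s t ≤ ω r t
  small : ∀ δ : ℝ, 0 < δ → ∃ ε : ℝ, 0 < ε ∧
    ∀ s ∈ 𝕋, ∀ t ∈ 𝕋, s ≤ t → t ≤ s + ε → ω s t < δ

/-! ### The (completed) tensor square of a normed space -/

section Tensor

variable (U : Type*) [NormedAddCommGroup U] [NormedSpace ℝ U]

/-- A norm on the algebraic tensor product `U ⊗ U` with `|u ⊗ v| ≤ |u| |v|`, for which the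
functionals `α ⊗ β`, with `α` and `β` continuous linear forms on `U`, are bounded
(the last condition holds for every norm if `U` is finite-dimensional, and for the projective, the
injective and the Hilbert-Schmidt norms; without it a term such as `df(a)·f(a)` would not act
continuously on `U ⊗ U`). -/
structure TensorNorm where
  toSeminorm : Seminorm ℝ (U ⊗[ℝ] U)
  eq_zero_of_eq_zero : ∀ z, toSeminorm z = 0 → z = 0
  tmul_le : ∀ u v : U, toSeminorm (u ⊗ₜ[ℝ] v) ≤ ‖u‖ * ‖v‖
  dual_le : ∃ C : ℝ, ∀ (α β : U →L[ℝ] ℝ) (z : U ⊗[ℝ] U),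
    |LinearMap.mul' ℝ ℝ (TensorProduct.map (α : U →ₗ[ℝ] ℝ) (β : U →ₗ[ℝ] ℝ) z)|
      ≤ C * ‖α‖ * ‖β‖ * toSeminorm z

variable {U}

/-- The algebraic tensor product `U ⊗ U` with the norm `N`. -/
def TensorNorm.Space (_N : TensorNorm U) : Type _ := U ⊗[ℝ] U

instance (N : TensorNorm U) : AddCommGroup N.Space :=
  inferInstanceAs (AddCommGroup (U ⊗[ℝ] U))

instance (N : TensorNorm U) : Module ℝ N.Space :=
  inferInstanceAs (Module ℝ (U ⊗[ℝ] U))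

/-- The norm of `N.Space`, as a group norm. -/
def TensorNorm.groupNorm (N : TensorNorm U) : AddGroupNorm N.Space where
  toFun z := N.toSeminorm z
  map_zero' := map_zero N.toSeminorm
  add_le' := map_add_le_add N.toSeminorm
  neg' := map_neg_eq_map N.toSeminorm
  eq_zero_of_map_eq_zero' := N.eq_zero_of_eq_zero

instance (N : TensorNorm U) : NormedAddCommGroup N.Space :=
  N.groupNorm.toNormedAddCommGroup

instance (N : TensorNorm U) : NormedSpace ℝ N.Space where
  norm_smul_le c z := (map_smul_eq_mul N.toSeminorm c z).le

/-- The completion of `U ⊗ U` for the norm `N`: the space of second levels of rough paths. -/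
abbrev TensorNorm.Completed (N : TensorNorm U) : Type _ := UniformSpace.Completion N.Space

/-- The tensor `u ⊗ v`, in the completed tensor product. -/
def TensorNorm.tmul (N : TensorNorm U) (u v : U) : N.Completed :=
  ((show N.Space from u ⊗ₜ[ℝ] v : N.Space) : UniformSpace.Completion N.Space)

end Tensor

/-! ### Rough paths -/

/-- `(1, x1, x2)` is a level-2 rough path over `𝕋` of finite `p`-variation controlled by `ω`, given
by its increments `x_{s,t} = x_s⁻¹ ⊗ x_t` in the truncated tensor algebra: Chen's relation
`x_{r,t} = x_{r,s} ⊗ x_{s,t}`, written level by level, and the two variation bounds. -/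
structure IsRoughPath {U : Type*} [NormedAddCommGroup U] [NormedSpace ℝ U] (N : TensorNorm U)
    (𝕋 : Set ℝ) (ω : ℝ → ℝ → ℝ) (p : ℝ) (x1 : ℝ → ℝ → U) (x2 : ℝ → ℝ → N.Completed) : Prop where
  chen1 : ∀ r ∈ 𝕋, ∀ s ∈ 𝕋, ∀ t ∈ 𝕋, r ≤ s → s ≤ t → x1 r t = x1 r s + x1 s t
  chen2 : ∀ r ∈ 𝕋, ∀ s ∈ 𝕋, ∀ t ∈ 𝕋, r ≤ s → s ≤ t →
    x2 r t = x2 r s + x2 s t + N.tmul (x1 r s) (x1 s t)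
  var1 : ∃ C : ℝ, ∀ s ∈ 𝕋, ∀ t ∈ 𝕋, s ≤ t → ‖x1 s t‖ ≤ C * ω s t ^ (1 / p)
  var2 : ∃ C : ℝ, ∀ s ∈ 𝕋, ∀ t ∈ 𝕋, s ≤ t → ‖x2 s t‖ ≤ C * ω s t ^ (2 / p)

/-! ### The vector field and the Davie almost flow -/

/-- The class `C_b^2 = C_b^{1+1}`: `f` is differentiable and bounded, and its derivative is bounded
and Lipschitz continuous. (Bounded functions of class `C²` with bounded derivatives up to order two
are of this kind.) -/
structure IsCbTwo {V W : Type*} [NormedAddCommGroup V] [NormedSpace ℝ V]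
    [NormedAddCommGroup W] [NormedSpace ℝ W] (f : V → W) : Prop where
  differentiable : Differentiable ℝ f
  bounded : ∃ C : ℝ, ∀ a, ‖f a‖ ≤ C
  fderiv_bounded : ∃ C : ℝ, ∀ a, ‖fderiv ℝ f a‖ ≤ C
  fderiv_lipschitz : ∃ C : ℝ, ∀ a b, ‖fderiv ℝ f a - fderiv ℝ f b‖ ≤ C * ‖a - b‖

section Davie

variable {U V : Type*} [NormedAddCommGroup U] [NormedSpace ℝ U]
  [NormedAddCommGroup V] [NormedSpace ℝ V]

/-- The linear map `df(a)·f(a)` on the algebraic tensor product: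
`u ⊗ v ↦ (df(a)(f(a) u)) v`. -/
def davieSecondAlg (N : TensorNorm U) (f : V → (U →L[ℝ] V)) (a : V) : N.Space →ₗ[ℝ] V :=
  (TensorProduct.lift
    ((ContinuousLinearMap.coeLM ℝ : (U →L[ℝ] V) →ₗ[ℝ] (U →ₗ[ℝ] V)).comp
      ((fderiv ℝ f a).comp (f a) : U →ₗ[ℝ] (U →L[ℝ] V))) : U ⊗[ℝ] U →ₗ[ℝ] V)

theorem davieSecondAlg_tmul (N : TensorNorm U) (f : V → (U →L[ℝ] V)) (a : V) (u v : U) :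
    davieSecondAlg N f a (show N.Space from u ⊗ₜ[ℝ] v) = fderiv ℝ f a (f a u) v := rfl

variable [FiniteDimensional ℝ V]

theorem davieSecondAlg_bounded (N : TensorNorm U) (f : V → (U →L[ℝ] V)) (a : V) :
    ∃ C : ℝ, ∀ z : N.Space, ‖davieSecondAlg N f a z‖ ≤ C * ‖z‖ := by
  obtain ⟨C, hC⟩ := N.dual_le
  let b := Module.finBasis ℝ V
  let c : Fin (Module.finrank ℝ V) → (V →L[ℝ] ℝ) := fun i =>
    LinearMap.toContinuousLinearMap (b.coord i)
  have key : ∀ z : U ⊗[ℝ] U, davieSecondAlg N f a (show N.Space from z) =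
      ∑ j, ∑ k, (LinearMap.mul' ℝ ℝ (TensorProduct.map
        (((c k).comp (f a) : U →L[ℝ] ℝ) : U →ₗ[ℝ] ℝ)
        (((c j).comp (fderiv ℝ f a (b k)) : U →L[ℝ] ℝ) : U →ₗ[ℝ] ℝ) z)) • b j := by
    intro z
    induction z using TensorProduct.induction_on with
    | zero =>
      have h : davieSecondAlg N f a (show N.Space from (0 : U ⊗[ℝ] U)) = 0 :=
        map_zero (davieSecondAlg N f a)
      rw [h]
      simp
    | tmul u v =>
      rw [davieSecondAlg_tmul]
      have h1 : fderiv ℝ f a (f a u) v = ∑ k, c k (f a u) • fderiv ℝ f a (b k) v := by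
        have h0 := congrArg (fun w => fderiv ℝ f a w v) (b.sum_repr (f a u))
        simp only [map_sum, map_smul, ContinuousLinearMap.sum_apply,
          ContinuousLinearMap.smul_apply] at h0
        exact h0.symm
      have h2 : ∀ w : V, w = ∑ j, c j w • b j := fun w => by
        conv_lhs => rw [← b.sum_repr w]
        simp [c]
      rw [h2 (fderiv ℝ f a (f a u) v)]
      refine Finset.sum_congr rfl fun j _ => ?_
      rw [h1, map_sum, Finset.sum_smul]
      refine Finset.sum_congr rfl fun k _ => ?_
      simp
    | add y z hy hz =>
      have h : davieSecondAlg N f a (show N.Space from y + z) =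
          davieSecondAlg N f a (show N.Space from y) +
            davieSecondAlg N f a (show N.Space from z) :=
        map_add (davieSecondAlg N f a) (show N.Space from y) (show N.Space from z)
      rw [h, hy, hz]
      simp only [map_add, add_smul, Finset.sum_add_distrib]
  refine ⟨∑ j, ∑ k, C * ‖(c k).comp (f a)‖ * ‖(c j).comp (fderiv ℝ f a (b k))‖ * ‖b j‖,
    fun z => ?_⟩
  have hz := key z
  refine (congrArg norm hz).le.trans ?_
  refine (norm_sum_le _ _).trans ?_
  rw [Finset.sum_mul]
  refine Finset.sum_le_sum fun j _ => (norm_sum_le _ _).trans ?_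
  rw [Finset.sum_mul]
  refine Finset.sum_le_sum fun k _ => ?_
  rw [norm_smul, Real.norm_eq_abs]
  have h := hC ((c k).comp (f a)) ((c j).comp (fderiv ℝ f a (b k))) z
  have h' := mul_le_mul_of_nonneg_right h (norm_nonneg (b j))
  refine h'.trans (le_of_eq ?_)
  have : ‖z‖ = N.toSeminorm z := rfl
  rw [this]
  ring

/-- The continuous extension of `df(a)·f(a)` to the completed tensor product. -/
def davieSecond (N : TensorNorm U) (f : V → (U →L[ℝ] V)) (a : V) : N.Completed →L[ℝ] V :=
  haveI := FiniteDimensional.complete ℝ V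
  (davieSecondAlg N f a).extendOfNorm
    (UniformSpace.Completion.toComplL (𝕜 := ℝ) (E := N.Space) : N.Space →ₗ[ℝ] N.Completed)

theorem davieSecond_tmul (N : TensorNorm U) (f : V → (U →L[ℝ] V)) (a : V) (u v : U) :
    davieSecond N f a (N.tmul u v) = fderiv ℝ f a (f a u) v := by
  have := FiniteDimensional.complete ℝ V
  obtain ⟨C, hC⟩ := davieSecondAlg_bounded N f a
  have h := LinearMap.extendOfNorm_eq (f := davieSecondAlg N f a)
    (e := (UniformSpace.Completion.toComplL (𝕜 := ℝ) (E := N.Space) : N.Space →ₗ[ℝ] N.Completed))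
    UniformSpace.Completion.denseRange_coe ⟨C, fun z => ?_⟩ (show N.Space from u ⊗ₜ[ℝ] v)
  · exact h
  · refine (hC z).trans (le_of_eq ?_)
    congr 1
    exact (UniformSpace.Completion.norm_coe z).symm

/-- The Davie almost flow
`φ_{t,s}(a) = a + f(a) x¹_{s,t} + df(a)·f(a) x²_{s,t}` (first argument `t`, second `s`). -/
def davieFlow (N : TensorNorm U) (f : V → (U →L[ℝ] V)) (x1 : ℝ → ℝ → U)
    (x2 : ℝ → ℝ → N.Completed) (t s : ℝ) (a : V) : V :=
  a + f a (x1 s t) + davieSecond N f a (x2 s t)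

end Davie

/-! ### Flows and galaxies -/

/-- The flow property of a family `ψ t s = ψ_{t,s}` of maps, `s ≤ t` in `𝕋`. -/
structure IsFlow {V : Type*} (𝕋 : Set ℝ) (ψ : ℝ → ℝ → V → V) : Prop where
  refl : ∀ t ∈ 𝕋, ∀ a, ψ t t a = a
  comp : ∀ r ∈ 𝕋, ∀ s ∈ 𝕋, ∀ t ∈ 𝕋, r ≤ s → s ≤ t → ∀ a, ψ t s (ψ s r a) = ψ t r a

/-- Two families are in the same galaxy for the weight `M`, the remainder `ϖ` and the control
`ω`. -/
def SameGalaxy {V : Type*} [PseudoMetricSpace V] (𝕋 : Set ℝ) (ω : ℝ → ℝ → ℝ) (M : V → ℝ)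
    (ϖ : ℝ → ℝ) (φ ψ : ℝ → ℝ → V → V) : Prop :=
  ∃ C : ℝ, ∀ s ∈ 𝕋, ∀ t ∈ 𝕋, s ≤ t → ∀ a, dist (φ t s a) (ψ t s a) ≤ C * M a * ϖ (ω s t)

end

noncomputable section

open Set Filter Topology

/-! ### Controls -/

namespace IsControl

variable {𝕋 : Set ℝ} {ω : ℝ → ℝ → ℝ}

/-! The solutions are replaced by approximate solutions: paths whose increments follow `φ` up to `L
ω^q`, with `q = 3/p`, wherever the control is at most `h`. If an interval is cut so that the control
halves, `sewing_step` turns an error constant `L` into `(1 + Λ²) 2^(-q) L` plus a fixed amount. For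
`Λ` close to `1` this is a contraction, because `q > 1`. So every approximate solution, whatever its
initial constant, satisfies the estimate with the one constant `sewingConst`
(`isApproxSol_sewingConst`). With this constant fixed, the solutions from a given point form a
nonempty compact set for the product topology (`nonempty_approxSolSet`, `isCompact_frozenSol`),
which varies measurably with the point (`measurableSet_hit`) and is stable under restarting and
under concatenation (`IsApproxSol.concat`).

Solutions need not be unique, so one must be chosen measurably and consistently in time. The choice
minimizes lexicographically the distances from `y r`, `r` rational, to the points of a dense
sequence, in an enumeration that does not depend on the starting time. Measurability is
`exists_measurable_lexMin`. The flow property holds because the tail of a minimizer is again a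
minimizer: otherwise, concatenating with a better tail would improve the whole path. This is
`IsLocalAlmostFlow.exists_measurable_flow`.

The Davie maps fit this frame (`exists_isLocalAlmostFlow_davieFlow`): Chen's relation cancels all
terms of the composition defect of order below `3/p`, and a Taylor bound controls the rest. -/

theorem le_of_subinterval (hω : IsControl 𝕋 ω) (h𝕋 : 𝕋.OrdConnected) {r s t v : ℝ}
    (hr : r ∈ 𝕋) (hv : v ∈ 𝕋) (hrs : r ≤ s) (hst : s ≤ t) (htv : t ≤ v) : ω s t ≤ ω r v := by
  have hs : s ∈ 𝕋 := h𝕋.out hr hv ⟨hrs, hst.trans htv⟩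
  have ht : t ∈ 𝕋 := h𝕋.out hr hv ⟨hrs.trans hst, htv⟩
  have h1 := hω.superadd r hr s hs t ht hrs hst
  have h2 := hω.superadd r hr t ht v hv (hrs.trans hst) htv
  have h3 := hω.nonneg r hr s hs hrs
  have h4 := hω.nonneg t ht v hv htv
  linarith

/-- A control can be halved, up to an arbitrarily small middle interval. -/
theorem exists_split (hω : IsControl 𝕋 ω) (h𝕋 : 𝕋.OrdConnected) {u t : ℝ}
    (hu : u ∈ 𝕋) (ht : t ∈ 𝕋) (hut : u ≤ t) {η : ℝ} (hη : 0 < η) :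
    ∃ a b, u ≤ a ∧ a ≤ b ∧ b ≤ t ∧ ω u a ≤ ω u t / 2 ∧ ω b t ≤ ω u t / 2 ∧ ω a b < η := by
  obtain ⟨ε, hε, hsmall⟩ := hω.small η hη
  have h0 := hω.nonneg u hu t ht hut
  -- The supremum of `S` need not belong to `S`, as `ω` need not be continuous in its second
  -- variable. So `a` is taken in `S` within `ε / 2` below it and `b` at most `ε / 2` above it;
  -- beyond `S`, superadditivity bounds the control of the remaining interval.
  set S : Set ℝ := {v | v ∈ Icc u t ∧ ω u v ≤ ω u t / 2} with hS
  have huS : u ∈ S := ⟨⟨le_rfl, hut⟩, by rw [hω.diag u hu]; positivity⟩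
  have hbdd : BddAbove S := ⟨t, fun v hv => hv.1.2⟩
  obtain ⟨a, haS, ha⟩ := exists_lt_of_lt_csSup ⟨u, huS⟩
    (show sSup S - ε / 2 < sSup S by linarith)
  have ham : a ≤ sSup S := le_csSup hbdd haS
  have hmt : sSup S ≤ t := csSup_le ⟨u, huS⟩ fun v hv => hv.1.2
  have hab : a ≤ min t (sSup S + ε / 2) := le_min haS.1.2 (by linarith)
  have hbt : min t (sSup S + ε / 2) ≤ t := min_le_left _ _
  have hub : u ≤ min t (sSup S + ε / 2) := haS.1.1.trans hab
  have hb : min t (sSup S + ε / 2) ∈ 𝕋 := h𝕋.out hu ht ⟨hub, hbt⟩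
  refine ⟨a, min t (sSup S + ε / 2), haS.1.1, hab, hbt, haS.2, ?_, ?_⟩
  · rcases le_total t (sSup S + ε / 2) with h | h
    · rw [min_eq_left h, hω.diag t ht]
      positivity
    · rw [min_eq_right h] at hb hub hbt ⊢
      have hnot : sSup S + ε / 2 ∉ S := fun hmem => by
        have := le_csSup hbdd hmem
        linarith
      have hlt : ω u t / 2 < ω u (sSup S + ε / 2) := by
        by_contra hcon
        exact hnot ⟨⟨hub, hbt⟩, not_lt.1 hcon⟩
      have := hω.superadd u hu _ hb t ht hub hbt
      linarith
  · refine hsmall a (h𝕋.out hu ht haS.1) _ hb hab ?_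
    have := min_le_right t (sSup S + ε / 2)
    linarith

/-- On a finite set of times, a control can be halved around two consecutive points. -/
theorem exists_split_finset (hω : IsControl 𝕋 ω) {P : Finset ℝ} (hP : ∀ v ∈ P, v ∈ 𝕋)
    {u t : ℝ} (hu : u ∈ P) (ht : t ∈ P) (hut : u < t) :
    ∃ a ∈ P, ∃ b ∈ P, u ≤ a ∧ a < b ∧ b ≤ t ∧ ω u a ≤ ω u t / 2 ∧ ω b t ≤ ω u t / 2 ∧
      ∀ v ∈ P, a < v → b ≤ v := by
  classical
  have h0 := hω.nonneg u (hP u hu) t (hP t ht) hut.le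
  -- The condition `v < t` guarantees that the last point of `S` has a successor in `P`, also when
  -- `ω u t = 0`.
  set S := P.filter fun v => u ≤ v ∧ v < t ∧ ω u v ≤ ω u t / 2 with hS
  have huS : u ∈ S := Finset.mem_filter.2
    ⟨hu, le_rfl, hut, by rw [hω.diag u (hP u hu)]; positivity⟩
  obtain ⟨haP, hua, hat, hωa⟩ := Finset.mem_filter.1 (S.max'_mem ⟨u, huS⟩)
  set a := S.max' ⟨u, huS⟩ with ha
  set R := P.filter fun v => a < v with hR
  have htR : t ∈ R := Finset.mem_filter.2 ⟨ht, hat⟩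
  obtain ⟨hbP, hab⟩ := Finset.mem_filter.1 (R.min'_mem ⟨t, htR⟩)
  have hbt : R.min' ⟨t, htR⟩ ≤ t := R.min'_le t htR
  set b := R.min' ⟨t, htR⟩ with hb
  refine ⟨a, haP, b, hbP, hua, hab, hbt, hωa, ?_, fun v hv hav =>
    R.min'_le v (Finset.mem_filter.2 ⟨hv, hav⟩)⟩
  rcases hbt.eq_or_lt with h | h
  · rw [h, hω.diag t (hP t ht)]
    positivity
  · have hlt : ω u t / 2 < ω u b := by
      by_contra hcon
      have := S.le_max' b (Finset.mem_filter.2 ⟨hbP, hua.trans hab.le, h, not_lt.1 hcon⟩)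
      linarith
    have := hω.superadd u (hP u hu) b (hP b hbP) t (hP t ht) (hua.trans hab.le) hbt
    linarith

end IsControl

/-! ### Almost flows and their approximate solutions -/

/-- A family of maps which is Lipschitz, moves points little and is a flow up to an error
`A ω^q`, at all times whose control is at most `h`. For a larger control, only the displacement is
bounded. -/
structure IsLocalAlmostFlow {E : Type*} [MetricSpace E] (𝕋 : Set ℝ) (ω : ℝ → ℝ → ℝ)
    (h q ρ Λ A K : ℝ) (φ : ℝ → ℝ → E → E) : Prop where
  h_pos : 0 < h
  one_le_q : 1 ≤ q
  ρ_pos : 0 < ρ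
  Λ_nonneg : 0 ≤ Λ
  A_nonneg : 0 ≤ A
  K_nonneg : 0 ≤ K
  contraction : (1 + Λ ^ 2) * (1 / 2) ^ q < 1
  lipschitz : ∀ s ∈ 𝕋, ∀ t ∈ 𝕋, s ≤ t → ω s t ≤ h → ∀ a b,
    dist (φ t s a) (φ t s b) ≤ Λ * dist a b
  almost_comp : ∀ r ∈ 𝕋, ∀ s ∈ 𝕋, ∀ t ∈ 𝕋, r ≤ s → s ≤ t → ω r t ≤ h → ∀ a,
    dist (φ t s (φ s r a)) (φ t r a) ≤ A * ω r t ^ q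
  dist_self_le : ∀ s ∈ 𝕋, ∀ t ∈ 𝕋, s ≤ t → ω s t ≤ h → ∀ a, dist (φ t s a) a ≤ K * ω s t ^ ρ
  dist_self_le_of_ge : ∀ s ∈ 𝕋, ∀ t ∈ 𝕋, s ≤ t → h ≤ ω s t → ∀ a,
    dist (φ t s a) a ≤ K * ω s t ^ q

/-- A path after time `s` whose increments follow `φ` up to an error `L ω^q`. -/
def IsApproxSol {E : Type*} [MetricSpace E] (𝕋 : Set ℝ) (ω : ℝ → ℝ → ℝ) (h q : ℝ)
    (φ : ℝ → ℝ → E → E) (L s : ℝ) (y : ℝ → E) : Prop :=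
  ∀ u ∈ 𝕋, ∀ t ∈ 𝕋, s ≤ u → u ≤ t → ω u t ≤ h → dist (y t) (φ t u (y u)) ≤ L * ω u t ^ q

/-- The contraction factor of the sewing iteration. -/
def sewingFactor (q Λ : ℝ) : ℝ := (1 + Λ ^ 2) * (1 / 2) ^ q

/-- The universal constant of approximate solutions. -/
def sewingConst (q Λ A : ℝ) : ℝ := (Λ + 1) * A / (1 - sewingFactor q Λ)

namespace IsLocalAlmostFlow

variable {E : Type*} [MetricSpace E] {𝕋 : Set ℝ} {ω : ℝ → ℝ → ℝ} {h q ρ Λ A K : ℝ}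
  {φ : ℝ → ℝ → E → E}

theorem refl (hφ : IsLocalAlmostFlow 𝕋 ω h q ρ Λ A K φ) (hω : IsControl 𝕋 ω) {t : ℝ}
    (ht : t ∈ 𝕋) (a : E) : φ t t a = a := by
  have h1 := hφ.dist_self_le t ht t ht le_rfl (by rw [hω.diag t ht]; exact hφ.h_pos.le) a
  rw [hω.diag t ht, Real.zero_rpow hφ.ρ_pos.ne', mul_zero] at h1
  exact dist_le_zero.1 h1

theorem continuous (hφ : IsLocalAlmostFlow 𝕋 ω h q ρ Λ A K φ) {s t : ℝ} (hs : s ∈ 𝕋)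
    (ht : t ∈ 𝕋) (hst : s ≤ t) (hh : ω s t ≤ h) : Continuous (φ t s) :=
  (LipschitzWith.of_dist_le_mul (K := ⟨Λ, hφ.Λ_nonneg⟩)
    (hφ.lipschitz s hs t ht hst hh)).continuous

theorem sewingFactor_nonneg (q Λ : ℝ) : 0 ≤ sewingFactor q Λ := by
  unfold sewingFactor
  positivity

theorem sewingConst_nonneg (hφ : IsLocalAlmostFlow 𝕋 ω h q ρ Λ A K φ) :
    0 ≤ sewingConst q Λ A := by
  have h1 : 0 ≤ 1 - sewingFactor q Λ := sub_nonneg.2 hφ.contraction.le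
  have h2 := hφ.Λ_nonneg
  have h3 := hφ.A_nonneg
  unfold sewingConst
  positivity

/-- The fixed point of the affine map produced by `sewing_step`; inductions with this constant
therefore close without loss. -/
theorem sewingConst_fixed (hφ : IsLocalAlmostFlow 𝕋 ω h q ρ Λ A K φ) :
    sewingFactor q Λ * sewingConst q Λ A + (Λ + 1) * A = sewingConst q Λ A := by
  have h1 : 1 - sewingFactor q Λ ≠ 0 := (sub_pos.2 hφ.contraction).ne'
  unfold sewingConst
  field_simp
  ring

/-- The error over an interval, from the errors over its two halves and over the middle. -/
theorem sewing_step (hφ : IsLocalAlmostFlow 𝕋 ω h q ρ Λ A K φ) (hω : IsControl 𝕋 ω)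
    (h𝕋 : 𝕋.OrdConnected) {u a b t L η : ℝ} (hu : u ∈ 𝕋) (ht : t ∈ 𝕋) (hua : u ≤ a)
    (hab : a ≤ b) (hbt : b ≤ t) (hh : ω u t ≤ h) (hL : 0 ≤ L) (h1 : ω u a ≤ ω u t / 2)
    (h2 : ω b t ≤ ω u t / 2) {y : ℝ → E} (hya : dist (y a) (φ a u (y u)) ≤ L * ω u a ^ q)
    (hyt : dist (y t) (φ t b (y b)) ≤ L * ω b t ^ q) (hyb : dist (y b) (φ b a (y a)) ≤ η) :
    dist (y t) (φ t u (y u)) ≤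
      (sewingFactor q Λ * L + (Λ + 1) * A) * ω u t ^ q + Λ * η := by
  have ha : a ∈ 𝕋 := h𝕋.out hu ht ⟨hua, hab.trans hbt⟩
  have hb : b ∈ 𝕋 := h𝕋.out hu ht ⟨hua.trans hab, hbt⟩
  have hub := hua.trans hab
  have hut := hub.trans hbt
  have hΛ := hφ.Λ_nonneg
  have hA := hφ.A_nonneg
  have hq : 0 ≤ q := zero_le_one.trans hφ.one_le_q
  have n0 := hω.nonneg u hu t ht hut
  have half : ∀ x, 0 ≤ x → x ≤ ω u t / 2 → L * x ^ q ≤ L * ((1 / 2) ^ q * ω u t ^ q) := by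
    intro x hx hxu
    rw [← Real.mul_rpow (by norm_num) n0]
    gcongr
    linarith
  have ya := hya.trans (half _ (hω.nonneg u hu a ha hua) h1)
  have yt := hyt.trans (half _ (hω.nonneg b hb t ht hbt) h2)
  have wbt : ω b t ≤ h := (hω.le_of_subinterval h𝕋 hu ht hub hbt le_rfl).trans hh
  have wab : ω a b ≤ h := (hω.le_of_subinterval h𝕋 hu ht hua hab hbt).trans hh
  have wub' := hω.le_of_subinterval h𝕋 hu ht le_rfl hub hbt
  have wub : ω u b ≤ h := wub'.trans hh
  -- The path is compared with `φ` along `u, a, b, t`. The error of the first half passes through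
  -- two Lipschitz maps, hence `Λ²`, the error `η` of the middle through one, and that of the last
  -- half through none; two composition defects give `(Λ + 1) * A`.
  have e1 : dist (φ t b (y b)) (φ t b (φ b a (y a))) ≤ Λ * η :=
    (hφ.lipschitz b hb t ht hbt wbt _ _).trans (by gcongr)
  have e2 : dist (φ t b (φ b a (y a))) (φ t b (φ b a (φ a u (y u)))) ≤
      Λ * (Λ * (L * ((1 / 2) ^ q * ω u t ^ q))) :=
    (hφ.lipschitz b hb t ht hbt wbt _ _).trans (mul_le_mul_of_nonneg_left
      ((hφ.lipschitz a ha b hb hab wab _ _).trans (by gcongr)) hΛ)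
  have e3 : dist (φ t b (φ b a (φ a u (y u)))) (φ t b (φ b u (y u))) ≤
      Λ * (A * ω u t ^ q) := by
    refine (hφ.lipschitz b hb t ht hbt wbt _ _).trans (mul_le_mul_of_nonneg_left
      ((hφ.almost_comp u hu a ha b hb hua hab wub _).trans ?_) hΛ)
    have := hω.nonneg u hu b hb hub
    gcongr
  have e4 := hφ.almost_comp u hu b hb t ht hub hbt hh (y u)
  have t1 := dist_triangle (y t) (φ t b (y b)) (φ t u (y u))
  have t2 := dist_triangle (φ t b (y b)) (φ t b (φ b a (y a))) (φ t u (y u))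
  have t3 := dist_triangle (φ t b (φ b a (y a))) (φ t b (φ b a (φ a u (y u)))) (φ t u (y u))
  have t4 := dist_triangle (φ t b (φ b a (φ a u (y u)))) (φ t b (φ b u (y u))) (φ t u (y u))
  have hexp : (sewingFactor q Λ * L + (Λ + 1) * A) * ω u t ^ q + Λ * η =
      L * ((1 / 2) ^ q * ω u t ^ q) + Λ * η + Λ * (Λ * (L * ((1 / 2) ^ q * ω u t ^ q))) +
        Λ * (A * ω u t ^ q) + A * ω u t ^ q := by
    unfold sewingFactor
    ring
  rw [hexp]
  linarith

/-- The middle interval of a split can be taken with arbitrarily small control, so its contribution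
to `sewing_step` disappears in the limit. -/
theorem improve (hφ : IsLocalAlmostFlow 𝕋 ω h q ρ Λ A K φ) (hω : IsControl 𝕋 ω)
    (h𝕋 : 𝕋.OrdConnected) {s L : ℝ} (hL : 0 ≤ L) {y : ℝ → E}
    (hy : IsApproxSol 𝕋 ω h q φ L s y) :
    IsApproxSol 𝕋 ω h q φ (sewingFactor q Λ * L + (Λ + 1) * A) s y := by
  intro u hu t ht hsu hut hh
  have hq : 0 < q := zero_lt_one.trans_le hφ.one_le_q
  have hΛ := hφ.Λ_nonneg
  refine le_of_forall_pos_le_add fun τ hτ => ?_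
  have hlim : Tendsto (fun x : ℝ => Λ * (L * x ^ q)) (𝓝 0) (𝓝 0) := by
    have : ContinuousAt (fun x : ℝ => Λ * (L * x ^ q)) 0 :=
      ((Real.continuousAt_rpow_const 0 q (Or.inr hq.le)).const_mul L).const_mul Λ
    simpa [ContinuousAt, Real.zero_rpow hq.ne'] using this
  obtain ⟨η, hη, hηlt⟩ := Metric.eventually_nhds_iff.1 (hlim.eventually_lt_const hτ)
  obtain ⟨a, b, hua, hab, hbt, h1, h2, h3⟩ := hω.exists_split h𝕋 hu ht hut hη
  have ha : a ∈ 𝕋 := h𝕋.out hu ht ⟨hua, hab.trans hbt⟩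
  have hb : b ∈ 𝕋 := h𝕋.out hu ht ⟨hua.trans hab, hbt⟩
  have hsa := hsu.trans hua
  refine (hφ.sewing_step hω h𝕋 hu ht hua hab hbt hh hL h1 h2
    (hy u hu a ha hsu hua ((hω.le_of_subinterval h𝕋 hu ht le_rfl hua (hab.trans hbt)).trans hh))
    (hy b hb t ht (hsa.trans hab) hbt
      ((hω.le_of_subinterval h𝕋 hu ht (hua.trans hab) hbt le_rfl).trans hh))
    (hy a ha b hb hsa hab
      ((hω.le_of_subinterval h𝕋 hu ht hua hab hbt).trans hh))).trans ?_
  have h4 : Λ * (L * ω a b ^ q) < τ := hηlt (by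
    rw [Real.dist_eq, sub_zero, abs_of_nonneg (hω.nonneg a ha b hb hab)]
    exact h3)
  linarith

/-- The constant of an approximate solution may be taken universal. -/
theorem isApproxSol_sewingConst (hφ : IsLocalAlmostFlow 𝕋 ω h q ρ Λ A K φ)
    (hω : IsControl 𝕋 ω) (h𝕋 : 𝕋.OrdConnected) {s L : ℝ} (hL : 0 ≤ L) {y : ℝ → E}
    (hy : IsApproxSol 𝕋 ω h q φ L s y) : IsApproxSol 𝕋 ω h q φ (sewingConst q Λ A) s y := by
  have hk := sewingFactor_nonneg q Λ
  have hc := hφ.sewingConst_nonneg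
  -- Starting from the larger constant `L + sewingConst q Λ A`, each improvement shrinks only the
  -- excess over the fixed point.
  have hit : ∀ n : ℕ, IsApproxSol 𝕋 ω h q φ
      (sewingFactor q Λ ^ n * L + sewingConst q Λ A) s y := by
    intro n
    induction n with
    | zero =>
      intro u hu t ht hsu hut hh
      refine (hy u hu t ht hsu hut hh).trans ?_
      have := Real.rpow_nonneg (hω.nonneg u hu t ht hut) q
      gcongr
      simpa using hc
    | succ n ih =>
      have := hφ.improve hω h𝕋 (by positivity) ih
      rw [mul_add, add_assoc, hφ.sewingConst_fixed, ← mul_assoc, ← pow_succ'] at this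
      exact this
  intro u hu t ht hsu hut hh
  refine ge_of_tendsto' (x := atTop)
    (f := fun n : ℕ => (sewingFactor q Λ ^ n * L + sewingConst q Λ A) * ω u t ^ q) ?_
    fun n => hit n u hu t ht hsu hut hh
  have h1 := tendsto_pow_atTop_nhds_zero_of_lt_one hk hφ.contraction
  simpa using ((h1.mul_const L).add_const (sewingConst q Λ A)).mul_const (ω u t ^ q)

/-- Davie's estimate for the discrete solution along a finite set of times. -/
theorem discrete_estimate (hφ : IsLocalAlmostFlow 𝕋 ω h q ρ Λ A K φ) (hω : IsControl 𝕋 ω)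
    (h𝕋 : 𝕋.OrdConnected) {P : Finset ℝ} (hP : ∀ v ∈ P, v ∈ 𝕋) {y : ℝ → E}
    (hy : ∀ a ∈ P, ∀ b ∈ P, a < b → (∀ v ∈ P, a < v → b ≤ v) → y b = φ b a (y a)) :
    ∀ u ∈ P, ∀ t ∈ P, u ≤ t → ω u t ≤ h →
      dist (y t) (φ t u (y u)) ≤ sewingConst q Λ A * ω u t ^ q := by
  classical
  have hc := hφ.sewingConst_nonneg
  -- Induction on the number of points of `P` in `[u, t]`, so that the bound does not depend on the
  -- size of `P`.
  have main : ∀ n : ℕ, ∀ u ∈ P, ∀ t ∈ P, u ≤ t → ω u t ≤ h →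
      (P.filter fun v => u ≤ v ∧ v ≤ t).card ≤ n →
      dist (y t) (φ t u (y u)) ≤ sewingConst q Λ A * ω u t ^ q := by
    intro n
    induction n with
    | zero =>
      intro u hu t ht hut _ hcard
      have : u ∈ P.filter fun v => u ≤ v ∧ v ≤ t := Finset.mem_filter.2 ⟨hu, le_rfl, hut⟩
      rw [Finset.card_eq_zero.1 (Nat.le_zero.1 hcard)] at this
      simp at this
    | succ n ih =>
      intro u hu t ht hut hh hcard
      have hu' := hP u hu
      have ht' := hP t ht
      rcases hut.eq_or_lt with rfl | hlt
      · rw [hφ.refl hω hu', dist_self]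
        have := Real.rpow_nonneg (hω.nonneg u hu' u hu' le_rfl) q
        positivity
      obtain ⟨a, ha, b, hb, hua, hab, hbt, h1, h2, hcons⟩ := hω.exists_split_finset hP hu ht hlt
      have hsub : ∀ c d, u ≤ c → d ≤ t → (u < c ∨ d < t) →
          (P.filter fun v => c ≤ v ∧ v ≤ d).card ≤ n := by
        intro c d hc hd hcd
        refine Nat.le_of_lt_succ (lt_of_lt_of_le (Finset.card_lt_card ?_) hcard)
        rw [Finset.ssubset_iff_of_subset fun v hv => ?_]
        · rcases hcd with hlt' | hlt'
          · exact ⟨u, by simp [hu, hut], by simp [hlt']⟩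
          · exact ⟨t, by simp [ht, hut], by simp [hlt']⟩
        · simp only [Finset.mem_filter] at hv ⊢
          exact ⟨hv.1, hc.trans hv.2.1, hv.2.2.trans hd⟩
      -- Here `a` and `b` are consecutive in `P`, so the middle interval carries no error at all.
      have hst := hφ.sewing_step hω h𝕋 (η := 0) hu' ht' hua hab.le hbt hh hc h1 h2
        (ih u hu a ha hua
          ((hω.le_of_subinterval h𝕋 hu' ht' le_rfl hua (hab.le.trans hbt)).trans hh)
          (hsub u a le_rfl (hab.le.trans hbt) (Or.inr (hab.trans_le hbt))))
        (ih b hb t ht hbt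
          ((hω.le_of_subinterval h𝕋 hu' ht' (hua.trans hab.le) hbt le_rfl).trans hh)
          (hsub b t (hua.trans hab.le) le_rfl (Or.inl (hua.trans_lt hab))))
        (by rw [hy a ha b hb hab hcons, dist_self])
      rwa [hφ.sewingConst_fixed, mul_zero, add_zero] at hst
  exact fun u hu t ht hut hh => main _ u hu t ht hut hh le_rfl

end IsLocalAlmostFlow

/-- The discrete solution along a finite set of times. -/
theorem exists_discrete_path {E : Type*} (φ : ℝ → ℝ → E → E) (s : ℝ) (a : E) (P : Finset ℝ)
    (hs : s ∈ P) (hP : ∀ v ∈ P, s ≤ v) : ∃ y : ℝ → E, y s = a ∧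
      ∀ c ∈ P, ∀ b ∈ P, c < b → (∀ v ∈ P, c < v → b ≤ v) → y b = φ b c (y c) := by
  classical
  have main : ∀ Q : Finset ℝ, (∀ v ∈ Q, s < v) → ∃ y : ℝ → E, y s = a ∧
      ∀ c ∈ insert s Q, ∀ b ∈ insert s Q, c < b → (∀ v ∈ insert s Q, c < v → b ≤ v) →
        y b = φ b c (y c) := by
    intro Q
    induction Q using Finset.induction_on_max with
    | empty =>
      intro _
      refine ⟨fun _ => a, rfl, fun c hc b hb hcb _ => ?_⟩
      simp at hc hb
      subst hc hb
      exact absurd hcb (lt_irrefl _)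
    | insert m Q hm ih =>
      intro hQ
      obtain ⟨y, hys, hy⟩ := ih fun v hv => hQ v (Finset.mem_insert_of_mem hv)
      have hsm : s < m := hQ m (Finset.mem_insert_self _ _)
      have hlt : ∀ v ∈ insert s Q, v < m := fun v hv => by
        rcases Finset.mem_insert.1 hv with rfl | hv
        · exact hsm
        · exact hm v hv
      -- The predecessor of the new largest time `m`: the only consecutive pair that is added is
      -- `(k, m)`.
      set k := (insert s Q).max' ⟨s, Finset.mem_insert_self _ _⟩ with hk
      have hkQ : k ∈ insert s Q := Finset.max'_mem _ _
      have hins : insert s (insert m Q) = insert m (insert s Q) := Finset.insert_comm _ _ _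
      refine ⟨Function.update y m (φ m k (y k)), by
        rw [Function.update_of_ne hsm.ne, hys], ?_⟩
      rw [hins]
      intro c hc b hb hcb hcons
      have hcQ : c ∈ insert s Q := by
        rcases Finset.mem_insert.1 hc with rfl | h
        · rcases Finset.mem_insert.1 hb with rfl | h
          · exact absurd hcb (lt_irrefl _)
          · exact absurd hcb (hlt b h).not_gt
        · exact h
      rw [Function.update_of_ne (hlt c hcQ).ne]
      rcases Finset.mem_insert.1 hb with rfl | hbQ
      · have hck : c = k := by
          refine le_antisymm (Finset.le_max' _ c hcQ) (not_lt.1 fun hlt' => ?_)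
          exact absurd (hcons k (Finset.mem_insert_of_mem hkQ) hlt') (hlt k hkQ).not_ge
        rw [Function.update_self, hck]
      · rw [Function.update_of_ne (hlt b hbQ).ne]
        exact hy c hcQ b hbQ hcb fun v hv => hcons v (Finset.mem_insert_of_mem hv)
  obtain ⟨y, hys, hy⟩ := main (P.erase s) fun v hv =>
    lt_of_le_of_ne (hP v (Finset.mem_of_mem_erase hv)) (Finset.ne_of_mem_erase hv).symm
  rw [Finset.insert_erase hs] at hy
  exact ⟨y, hys, hy⟩

/-! ### Measurable lexicographic selection -/

/-- The points of `S` at which the first `n` functions are successively minimal. -/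
def lexArgmin {X : Type*} (F : ℕ → X → ℝ) (S : Set X) : ℕ → Set X
  | 0 => S
  | n + 1 => {y ∈ lexArgmin F S n | ∀ z ∈ lexArgmin F S n, F n y ≤ F n z}

section Selection

variable {X : Type*} {F : ℕ → X → ℝ} {S : Set X}

theorem lexArgmin_succ_subset (n : ℕ) : lexArgmin F S (n + 1) ⊆ lexArgmin F S n :=
  fun _ hy => hy.1

/-- A competitor tied with a full minimizer on the first `n` functions survives the first `n`
rounds, hence may be compared with it in the next one. -/
theorem mem_lexArgmin_of_eq {x y : X} (hx : ∀ n, x ∈ lexArgmin F S n) (hy : y ∈ S) {n : ℕ}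
    (h : ∀ m < n, F m y = F m x) : y ∈ lexArgmin F S n := by
  induction n with
  | zero => exact hy
  | succ n ih =>
    refine ⟨ih fun m hm => h m (hm.trans n.lt_succ_self), fun z hz => ?_⟩
    rw [h n n.lt_succ_self]
    exact (hx (n + 1)).2 z hz

variable [TopologicalSpace X]

theorem isClosed_lexArgmin (hF : ∀ n, Continuous (F n)) (hS : IsClosed S) (n : ℕ) :
    IsClosed (lexArgmin F S n) := by
  induction n with
  | zero => exact hS
  | succ n ih =>
    have : lexArgmin F S (n + 1) =
        lexArgmin F S n ∩ ⋂ z ∈ lexArgmin F S n, {y | F n y ≤ F n z} := by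
      ext y
      simp [lexArgmin]
    rw [this]
    exact ih.inter (isClosed_biInter fun z _ => isClosed_le (hF n) continuous_const)

theorem isCompact_lexArgmin (hF : ∀ n, Continuous (F n)) (hS : IsClosed S) (hS' : IsCompact S)
    (n : ℕ) : IsCompact (lexArgmin F S n) :=
  hS'.of_isClosed_subset (isClosed_lexArgmin hF hS n) <| by
    induction n with
    | zero => exact subset_rfl
    | succ n ih => exact (lexArgmin_succ_subset n).trans ih

theorem nonempty_lexArgmin (hF : ∀ n, Continuous (F n)) (hS : IsClosed S) (hS' : IsCompact S)
    (hne : S.Nonempty) (n : ℕ) : (lexArgmin F S n).Nonempty := by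
  induction n with
  | zero => exact hne
  | succ n ih =>
    obtain ⟨y, hy, hmin⟩ :=
      (isCompact_lexArgmin hF hS hS' n).exists_isMinOn ih (hF n).continuousOn
    exact ⟨y, hy, fun z hz => hmin hz⟩

theorem measurableSet_lexArgmin {A : Type*} [MeasurableSpace A] {S : A → Set X}
    (hF : ∀ n, Continuous (F n)) (hS : ∀ a, IsClosed (S a)) (hS' : ∀ a, IsCompact (S a))
    (hne : ∀ a, (S a).Nonempty)
    (hmeas : ∀ K : Set X, IsClosed K → MeasurableSet {a | (S a ∩ K).Nonempty}) (n : ℕ) :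
    ∀ K : Set X, IsClosed K → MeasurableSet {a | (lexArgmin F (S a) n ∩ K).Nonempty} := by
  induction n with
  | zero => exact hmeas
  | succ n ih =>
    intro K hK
    have hc : ∀ c : ℚ, IsClosed {y | F n y ≤ c} := fun c => isClosed_le (hF n) continuous_const
    -- `K` contains a minimizer iff the minimum over the part in `K` does not exceed the minimum
    -- over the whole set. Testing this against rational levels `c` needs only hitting sets of the
    -- previous stage, and countably many of them.
    have heq : {a | (lexArgmin F (S a) (n + 1) ∩ K).Nonempty} =
        ⋂ c : ℚ, {a | (lexArgmin F (S a) n ∩ {y | F n y ≤ c}).Nonempty}ᶜ ∪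
          {a | (lexArgmin F (S a) n ∩ (K ∩ {y | F n y ≤ c})).Nonempty} := by
      ext a
      simp only [mem_iInter, mem_union, mem_compl_iff, mem_ofPred_eq, ← imp_iff_not_or]
      constructor
      · rintro ⟨y, hy, hyK⟩ c ⟨z, hz, hzc⟩
        exact ⟨y, hy.1, hyK, (hy.2 z hz).trans hzc⟩
      · intro hall
        obtain ⟨x, hx⟩ := nonempty_lexArgmin hF (hS a) (hS' a) (hne a) (n + 1)
        have hcomp : IsCompact (lexArgmin F (S a) n ∩ K) :=
          (isCompact_lexArgmin hF (hS a) (hS' a) n).inter_right hK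
        have hlt : ∀ c : ℚ, F n x ≤ c → ∃ y ∈ lexArgmin F (S a) n ∩ K, F n y ≤ c := by
          intro c hxc
          obtain ⟨y, hy, hyK, hyc⟩ := hall c ⟨x, hx.1, hxc⟩
          exact ⟨y, ⟨hy, hyK⟩, hyc⟩
        have hne' : (lexArgmin F (S a) n ∩ K).Nonempty := by
          obtain ⟨c, hxc⟩ := exists_rat_gt (F n x)
          obtain ⟨y, hy, _⟩ := hlt c hxc.le
          exact ⟨y, hy⟩
        obtain ⟨y, hy, hmin⟩ := hcomp.exists_isMinOn hne' (hF n).continuousOn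
        have hyx : F n y ≤ F n x := by
          by_contra hcon
          obtain ⟨c, h1, h2⟩ := exists_rat_btwn (not_le.1 hcon)
          obtain ⟨z, hz, hzc⟩ := hlt c h1.le
          exact absurd (hmin hz) (not_le.2 (hzc.trans_lt h2))
        exact ⟨y, ⟨hy.1, fun z hz => hyx.trans (hx.2 z hz)⟩, hy.2⟩
    rw [heq]
    exact MeasurableSet.iInter fun c =>
      (ih _ (hc c)).compl.union (ih _ (hK.inter (hc c)))

/-- A measurable family of compact sets has a measurable selection, which minimizes
lexicographically a given separating sequence of continuous functions. -/
theorem exists_measurable_lexMin {A : Type*} [MeasurableSpace A] {S : A → Set X}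
    (hF : ∀ n, Continuous (F n)) (hS : ∀ a, IsClosed (S a)) (hS' : ∀ a, IsCompact (S a))
    (hne : ∀ a, (S a).Nonempty)
    (hmeas : ∀ K : Set X, IsClosed K → MeasurableSet {a | (S a ∩ K).Nonempty})
    (hsep : ∀ a, ∀ y ∈ S a, ∀ z ∈ S a, (∀ n, F n y = F n z) → y = z) :
    ∃ σ : A → X, (∀ a, σ a ∈ S a) ∧ (∀ K : Set X, IsClosed K → MeasurableSet {a | σ a ∈ K}) ∧
      ∀ a, ∀ y ∈ S a, ∀ n, (∀ m < n, F m y = F m (σ a)) → F n (σ a) ≤ F n y := by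
  have hinter : ∀ a, ∀ K : Set X, IsClosed K →
      (∀ n, (lexArgmin F (S a) n ∩ K).Nonempty) → ∃ x ∈ K, ∀ n, x ∈ lexArgmin F (S a) n := by
    intro a K hK hn
    obtain ⟨x, hx⟩ := IsCompact.nonempty_iInter_of_sequence_nonempty_isCompact_isClosed
      (fun n => lexArgmin F (S a) n ∩ K)
      (fun n => inter_subset_inter_left K (lexArgmin_succ_subset n)) hn
      ((isCompact_lexArgmin hF (hS a) (hS' a) 0).inter_right hK)
      (fun n => (isClosed_lexArgmin hF (hS a) n).inter hK)
    rw [mem_iInter] at hx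
    exact ⟨x, (hx 0).2, fun n => (hx n).1⟩
  have hex : ∀ a, ∃ x, ∀ n, x ∈ lexArgmin F (S a) n := fun a => by
    obtain ⟨x, _, hx⟩ := hinter a univ isClosed_univ fun n => by
      rw [inter_univ]
      exact nonempty_lexArgmin hF (hS a) (hS' a) (hne a) n
    exact ⟨x, hx⟩
  choose σ hσ using hex
  refine ⟨σ, fun a => hσ a 0, fun K hK => ?_, fun a y hy n hn =>
    (hσ a (n + 1)).2 y (mem_lexArgmin_of_eq (hσ a) hy hn)⟩
  have heq : {a | σ a ∈ K} = ⋂ n, {a | (lexArgmin F (S a) n ∩ K).Nonempty} := by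
    ext a
    simp only [mem_ofPred_eq, mem_iInter]
    refine ⟨fun h n => ⟨σ a, hσ a n, h⟩, fun h => ?_⟩
    obtain ⟨x, hxK, hx⟩ := hinter a K hK h
    have hxσ : x = σ a := hsep a x (hx 0) (σ a) (hσ a 0) fun n =>
      le_antisymm ((hx (n + 1)).2 _ (hσ a n)) ((hσ a (n + 1)).2 _ (hx n))
    rwa [← hxσ]
  rw [heq]
  exact MeasurableSet.iInter fun n => measurableSet_lexArgmin hF hS hS' hne hmeas n K hK

end Selection

/-! ### The sets of approximate solutions -/

namespace IsApproxSol

variable {E : Type*} [MetricSpace E] {𝕋 : Set ℝ} {ω : ℝ → ℝ → ℝ} {h q ρ Λ A K L : ℝ}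
  {φ : ℝ → ℝ → E → E} {s : ℝ} {y : ℝ → E}

theorem dist_le (hy : IsApproxSol 𝕋 ω h q φ L s y)
    (hφ : IsLocalAlmostFlow 𝕋 ω h q ρ Λ A K φ) {u t : ℝ} (hu : u ∈ 𝕋) (ht : t ∈ 𝕋)
    (hsu : s ≤ u) (hut : u ≤ t) (hh : ω u t ≤ h) :
    dist (y t) (y u) ≤ K * ω u t ^ ρ + L * ω u t ^ q := by
  have h1 := hy u hu t ht hsu hut hh
  have h2 := hφ.dist_self_le u hu t ht hut hh (y u)
  have h3 := dist_triangle (y t) (φ t u (y u)) (y u)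
  linarith

/-- The displacement of an approximate solution grows at most linearly in the control. -/
theorem dist_le_linear (hy : IsApproxSol 𝕋 ω h q φ L s y)
    (hφ : IsLocalAlmostFlow 𝕋 ω h q ρ Λ A K φ) (hω : IsControl 𝕋 ω) (h𝕋 : 𝕋.OrdConnected)
    (hL : 0 ≤ L) {u t : ℝ} (hu : u ∈ 𝕋) (ht : t ∈ 𝕋) (hsu : s ≤ u) (hut : u ≤ t) :
    dist (y t) (y u) ≤ (K * h ^ ρ + L * h ^ q) * (1 + 4 * (ω u t / h)) := by
  set M := K * h ^ ρ + L * h ^ q with hM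
  have hh0 := hφ.h_pos
  have hK := hφ.K_nonneg
  have hq : 0 ≤ q := zero_le_one.trans hφ.one_le_q
  have hρ := hφ.ρ_pos
  have hM0 : 0 ≤ M := by positivity
  have hsmall : ∀ u ∈ 𝕋, ∀ t ∈ 𝕋, s ≤ u → u ≤ t → ω u t ≤ h → dist (y t) (y u) ≤ M := by
    intro u hu t ht hsu hut hh
    have := hω.nonneg u hu t ht hut
    refine (hy.dist_le hφ hu ht hsu hut hh).trans ?_
    rw [hM]
    gcongr
  -- Each doubling of the control costs two halves and one middle piece bounded by `M`: `2 (2^(n+1)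
  -- - 1) + 1 = 2^(n+2) - 1`.
  have hind : ∀ n : ℕ, ∀ u ∈ 𝕋, ∀ t ∈ 𝕋, s ≤ u → u ≤ t → ω u t ≤ 2 ^ n * h →
      dist (y t) (y u) ≤ (2 ^ (n + 1) - 1) * M := by
    intro n
    induction n with
    | zero =>
      intro u hu t ht hsu hut hh
      have := hsmall u hu t ht hsu hut (by simpa using hh)
      norm_num
      exact this
    | succ n ih =>
      intro u hu t ht hsu hut hh
      obtain ⟨a, b, hua, hab, hbt, h1, h2, h3⟩ := hω.exists_split h𝕋 hu ht hut hh0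
      have ha : a ∈ 𝕋 := h𝕋.out hu ht ⟨hua, hab.trans hbt⟩
      have hb : b ∈ 𝕋 := h𝕋.out hu ht ⟨hua.trans hab, hbt⟩
      have hsa := hsu.trans hua
      have hhalf : ω u t / 2 ≤ 2 ^ n * h := by
        rw [pow_succ] at hh
        linarith
      have d1 := ih u hu a ha hsu hua (h1.trans hhalf)
      have d2 := hsmall a ha b hb hsa hab h3.le
      have d3 := ih b hb t ht (hsa.trans hab) hbt (h2.trans hhalf)
      have t1 := dist_triangle (y t) (y b) (y u)
      have t2 := dist_triangle (y b) (y a) (y u)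
      have : (2 ^ (n + 1 + 1) - 1) * M =
          (2 ^ (n + 1) - 1) * M + M + (2 ^ (n + 1) - 1) * M := by ring
      linarith
  have n0 := hω.nonneg u hu t ht hut
  rcases le_total (ω u t) h with hh | hh
  · refine (hsmall u hu t ht hsu hut hh).trans (le_mul_of_one_le_right hM0 ?_)
    have : 0 ≤ ω u t / h := by positivity
    linarith
  · obtain ⟨n, hn1, hn2⟩ := exists_nat_pow_near ((one_le_div hh0).2 hh) (one_lt_two (α := ℝ))
    refine (hind (n + 1) u hu t ht hsu hut ((div_le_iff₀ hh0).1 hn2.le)).trans ?_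
    rw [mul_comm M]
    refine mul_le_mul_of_nonneg_right ?_ hM0
    have : (2 : ℝ) ^ (n + 1 + 1) = 4 * 2 ^ n := by ring
    linarith

theorem continuousOn (hy : IsApproxSol 𝕋 ω h q φ L s y)
    (hφ : IsLocalAlmostFlow 𝕋 ω h q ρ Λ A K φ) (hω : IsControl 𝕋 ω) :
    ContinuousOn y (𝕋 ∩ Ici s) := by
  have hq : 0 < q := zero_lt_one.trans_le hφ.one_le_q
  rw [Metric.continuousOn_iff]
  intro u hu τ hτ
  have hlim : Tendsto (fun x : ℝ => K * x ^ ρ + L * x ^ q) (𝓝 0) (𝓝 0) := by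
    have : ContinuousAt (fun x : ℝ => K * x ^ ρ + L * x ^ q) 0 :=
      ((Real.continuousAt_rpow_const 0 ρ (Or.inr hφ.ρ_pos.le)).const_mul K).add
        ((Real.continuousAt_rpow_const 0 q (Or.inr hq.le)).const_mul L)
    simpa [ContinuousAt, Real.zero_rpow hq.ne', Real.zero_rpow hφ.ρ_pos.ne'] using this
  obtain ⟨η, hη, hηlt⟩ := Metric.eventually_nhds_iff.1 (hlim.eventually_lt_const hτ)
  obtain ⟨ε, hε, hsmall⟩ := hω.small (min η h) (lt_min hη hφ.h_pos)
  have key : ∀ a ∈ 𝕋, ∀ b ∈ 𝕋, s ≤ a → a ≤ b → b ≤ a + ε → dist (y b) (y a) < τ := by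
    intro a ha b hb hsa hab hba
    have hw := hsmall a ha b hb hab hba
    refine (hy.dist_le hφ ha hb hsa hab (hw.le.trans (min_le_right _ _))).trans_lt (hηlt ?_)
    rw [Real.dist_eq, sub_zero, abs_of_nonneg (hω.nonneg a ha b hb hab)]
    exact hw.trans_le (min_le_left _ _)
  refine ⟨ε, hε, fun t ht htu => ?_⟩
  rw [Real.dist_eq, abs_lt] at htu
  rcases le_total u t with hut | hut
  · exact key u hu.1 t ht.1 hu.2 hut (by linarith)
  · rw [dist_comm]
    exact key t ht.1 u hu.1 ht.2 hut (by linarith)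

/-- Two approximate solutions can be concatenated. -/
theorem concat (hφ : IsLocalAlmostFlow 𝕋 ω h q ρ Λ A K φ) (hω : IsControl 𝕋 ω)
    (h𝕋 : 𝕋.OrdConnected) {r : ℝ} (hs : s ∈ 𝕋) {z : ℝ → E}
    (hy : IsApproxSol 𝕋 ω h q φ (sewingConst q Λ A) r y)
    (hz : IsApproxSol 𝕋 ω h q φ (sewingConst q Λ A) s z) (hyz : z s = y s) {w : ℝ → E}
    (hw₁ : ∀ t ∈ 𝕋, t ≤ s → w t = y t) (hw₂ : ∀ t ∈ 𝕋, s ≤ t → w t = z t) :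
    IsApproxSol 𝕋 ω h q φ (sewingConst q Λ A) r w := by
  have hc := hφ.sewingConst_nonneg
  have hΛ := hφ.Λ_nonneg
  have hA := hφ.A_nonneg
  have hq : 0 ≤ q := zero_le_one.trans hφ.one_le_q
  set L := sewingConst q Λ A with hLdef
  -- Crossing the junction `s` worsens the constant to `L + Λ * L + A`, which is harmless: any
  -- finite constant improves back to `sewingConst q Λ A`.
  refine hφ.isApproxSol_sewingConst hω h𝕋 (L := L + Λ * L + A) (by positivity) ?_
  intro u hu t ht hru hut hh
  have n0 := hω.nonneg u hu t ht hut
  have hle : L ≤ L + Λ * L + A := by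
    have : 0 ≤ Λ * L := by positivity
    linarith
  have hle' := mul_le_mul_of_nonneg_right hle (Real.rpow_nonneg n0 q)
  rcases le_total t s with hts | hst
  · rw [hw₁ t ht hts, hw₁ u hu (hut.trans hts)]
    exact (hy u hu t ht hru hut hh).trans hle'
  rcases le_total s u with hsu | hus
  · rw [hw₂ t ht hst, hw₂ u hu hsu]
    exact (hz u hu t ht hsu hut hh).trans hle'
  rw [hw₂ t ht hst, hw₁ u hu hus]
  have w1 := hω.le_of_subinterval h𝕋 hu ht le_rfl hus hst
  have w2 := hω.le_of_subinterval h𝕋 hu ht hus hst le_rfl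
  have m1 := hω.nonneg u hu s hs hus
  have m2 := hω.nonneg s hs t ht hst
  have e1 : dist (z t) (φ t s (y s)) ≤ L * ω u t ^ q := by
    rw [← hyz]
    exact (hz s hs t ht le_rfl hst (w2.trans hh)).trans (by gcongr)
  have e2 : dist (φ t s (y s)) (φ t s (φ s u (y u))) ≤ Λ * (L * ω u t ^ q) :=
    (hφ.lipschitz s hs t ht hst (w2.trans hh) _ _).trans (mul_le_mul_of_nonneg_left
      ((hy u hu s hs hru hus (w1.trans hh)).trans (by gcongr)) hΛ)
  have e3 := hφ.almost_comp u hu s hs t ht hus hst hh (y u)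
  have t1 := dist_triangle (z t) (φ t s (y s)) (φ t u (y u))
  have t2 := dist_triangle (φ t s (y s)) (φ t s (φ s u (y u))) (φ t u (y u))
  have : (L + Λ * L + A) * ω u t ^ q =
      L * ω u t ^ q + Λ * (L * ω u t ^ q) + A * ω u t ^ q := by ring
  linarith

end IsApproxSol

/-- The approximate solutions starting from `a` at time `s`, frozen outside of `𝕋 ∩ [s, ∞)`. -/
def approxSolSet {E : Type*} [MetricSpace E] (𝕋 : Set ℝ) (ω : ℝ → ℝ → ℝ) (h q : ℝ)
    (φ : ℝ → ℝ → E → E) (L s : ℝ) (a : E) : Set (ℝ → E) :=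
  {y | y s = a ∧ (∀ t, t ∉ 𝕋 ∩ Ici s → y t = a) ∧ IsApproxSol 𝕋 ω h q φ L s y}

namespace IsLocalAlmostFlow

variable {E : Type*} [MetricSpace E] {𝕋 : Set ℝ} {ω : ℝ → ℝ → ℝ} {h q ρ Λ A K : ℝ}
  {φ : ℝ → ℝ → E → E}

theorem isClosed_isApproxSol (hφ : IsLocalAlmostFlow 𝕋 ω h q ρ Λ A K φ) (L s : ℝ) :
    IsClosed {y : ℝ → E | IsApproxSol 𝕋 ω h q φ L s y} := by
  simp only [IsApproxSol, ofPred_forall]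
  refine isClosed_iInter fun u => isClosed_iInter fun hu => isClosed_iInter fun t =>
    isClosed_iInter fun ht => isClosed_iInter fun _ => isClosed_iInter fun hut =>
    isClosed_iInter fun hh => isClosed_le ?_ continuous_const
  exact (continuous_apply t).dist ((hφ.continuous hu ht hut hh).comp (continuous_apply u))

/-- The initial point is left free here: the solution sets from all points form one closed set,
whose compact pieces are then projected by `y ↦ y s`. -/
theorem isClosed_frozenSol (hφ : IsLocalAlmostFlow 𝕋 ω h q ρ Λ A K φ) (L s : ℝ) :
    IsClosed {y : ℝ → E | y ∈ approxSolSet 𝕋 ω h q φ L s (y s)} := by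
  have : {y : ℝ → E | y ∈ approxSolSet 𝕋 ω h q φ L s (y s)} =
      (⋂ t, ⋂ _ : t ∉ 𝕋 ∩ Ici s, {y : ℝ → E | y t = y s}) ∩
        {y : ℝ → E | IsApproxSol 𝕋 ω h q φ L s y} := by
    ext y
    simp [approxSolSet]
  rw [this]
  exact (isClosed_iInter fun t => isClosed_iInter fun _ =>
    isClosed_eq (continuous_apply t) (continuous_apply s)).inter (hφ.isClosed_isApproxSol L s)

/-- Tychonoff's theorem: at each time, `dist_le_linear` confines the paths to a closed ball, compact
because `E` is proper. -/
theorem isCompact_frozenSol [ProperSpace E] (hφ : IsLocalAlmostFlow 𝕋 ω h q ρ Λ A K φ)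
    (hω : IsControl 𝕋 ω) (h𝕋 : 𝕋.OrdConnected) {L : ℝ} (hL : 0 ≤ L) {s : ℝ} (hs : s ∈ 𝕋)
    (o : E) (R : ℝ) :
    IsCompact ({y : ℝ → E | y ∈ approxSolSet 𝕋 ω h q φ L s (y s)} ∩
      {y | y s ∈ Metric.closedBall o R}) := by
  have hq : 0 ≤ q := zero_le_one.trans hφ.one_le_q
  refine IsCompact.of_isClosed_subset (isCompact_univ_pi fun t : ℝ =>
    isCompact_closedBall o (|(K * h ^ ρ + L * h ^ q) * (1 + 4 * (ω s t / h))| + R))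
    ((hφ.isClosed_frozenSol L s).inter
      (Metric.isClosed_closedBall.preimage (continuous_apply s))) ?_
  rintro y ⟨⟨-, hfr, hy⟩, hyR⟩ t -
  rw [mem_ofPred_eq, Metric.mem_closedBall] at hyR
  rw [Metric.mem_closedBall]
  have hab := abs_nonneg ((K * h ^ ρ + L * h ^ q) * (1 + 4 * (ω s t / h)))
  by_cases ht : t ∈ 𝕋 ∩ Ici s
  · have h1 := hy.dist_le_linear hφ hω h𝕋 hL hs ht.1 le_rfl ht.2
    have h2 := dist_triangle (y t) (y s) o
    have h3 := le_abs_self ((K * h ^ ρ + L * h ^ q) * (1 + 4 * (ω s t / h)))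
    linarith
  · rw [hfr t ht]
    linarith

theorem approxSolSet_eq (L s : ℝ) (a : E) : approxSolSet 𝕋 ω h q φ L s a =
    ({y : ℝ → E | y ∈ approxSolSet 𝕋 ω h q φ L s (y s)} ∩
      {y | y s ∈ Metric.closedBall a 0}) := by
  ext y
  simp only [Metric.closedBall_zero, mem_singleton_iff, mem_inter_iff, mem_ofPred_eq]
  constructor
  · intro hy
    refine ⟨?_, hy.1⟩
    rw [hy.1]
    exact hy
  · rintro ⟨h1, h2⟩
    rwa [h2] at h1

/-- Hitting sets of the approximate solutions are countable unions of compact sets. -/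
theorem measurableSet_hit [ProperSpace E] [MeasurableSpace E] [BorelSpace E]
    (hφ : IsLocalAlmostFlow 𝕋 ω h q ρ Λ A K φ)
    (hω : IsControl 𝕋 ω) (h𝕋 : 𝕋.OrdConnected) {L : ℝ} (hL : 0 ≤ L) {s : ℝ} (hs : s ∈ 𝕋)
    (C : Set (ℝ → E)) (hC : IsClosed C) :
    MeasurableSet {a | (approxSolSet 𝕋 ω h q φ L s a ∩ C).Nonempty} := by
  rcases isEmpty_or_nonempty E with hE | ⟨⟨o⟩⟩
  · rw [eq_empty_of_isEmpty {a | (approxSolSet 𝕋 ω h q φ L s a ∩ C).Nonempty}]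
    exact MeasurableSet.empty
  have heq : {a | (approxSolSet 𝕋 ω h q φ L s a ∩ C).Nonempty} =
      ⋃ n : ℕ, (fun y : ℝ → E => y s) '' (({y : ℝ → E | y ∈ approxSolSet 𝕋 ω h q φ L s (y s)} ∩
        {y | y s ∈ Metric.closedBall o n}) ∩ C) := by
    ext a
    simp only [mem_iUnion, mem_image, mem_ofPred_eq]
    constructor
    · rintro ⟨y, hy, hyC⟩
      obtain ⟨n, hn⟩ := exists_nat_ge (dist a o)
      have hya := hy.1
      subst hya
      exact ⟨n, y, ⟨⟨hy, hn⟩, hyC⟩, rfl⟩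
    · rintro ⟨n, y, ⟨⟨hy, -⟩, hyC⟩, rfl⟩
      exact ⟨y, hy, hyC⟩
  rw [heq]
  exact MeasurableSet.iUnion fun n => (((hφ.isCompact_frozenSol hω h𝕋 hL hs o n).inter_right
    hC).image (continuous_apply s)).isClosed.measurableSet

end IsLocalAlmostFlow

/-! ### Existence of approximate solutions by compactness -/

namespace IsLocalAlmostFlow

variable {E : Type*} [MetricSpace E] {𝕋 : Set ℝ} {ω : ℝ → ℝ → ℝ} {h q ρ Λ A K : ℝ}
  {φ : ℝ → ℝ → E → E}

/-- The discrete solution on a set containing a fine grid moves at bounded speed. -/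
theorem discrete_dist_le (hφ : IsLocalAlmostFlow 𝕋 ω h q ρ Λ A K φ) (hω : IsControl 𝕋 ω)
    {ε : ℝ}
    (hsmall : ∀ s ∈ 𝕋, ∀ t ∈ 𝕋, s ≤ t → t ≤ s + ε → ω s t < h) {P : Finset ℝ}
    (hP : ∀ v ∈ P, v ∈ 𝕋) {s L : ℝ} (hL : 0 ≤ L) (hsP : ∀ v ∈ P, s ≤ v)
    (hgrid : ∀ n : ℕ, ∀ t ∈ P, s + n * ε ≤ t → s + n * ε ∈ P) {y : ℝ → E}
    (hy : ∀ u ∈ P, ∀ t ∈ P, u ≤ t → ω u t ≤ h → dist (y t) (φ t u (y u)) ≤ L * ω u t ^ q)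
    (n : ℕ) : ∀ t ∈ P, t ≤ s + n * ε → dist (y t) (y s) ≤ (K * h ^ ρ + L * h ^ q) * n := by
  have hh0 := hφ.h_pos
  have hK := hφ.K_nonneg
  have hq : 0 ≤ q := zero_le_one.trans hφ.one_le_q
  have hρ := hφ.ρ_pos
  induction n with
  | zero =>
    intro t ht hts
    rw [Nat.cast_zero, zero_mul, add_zero] at hts
    rw [le_antisymm hts (hsP t ht), dist_self]
    simp
  | succ n ih =>
    intro t ht hts
    rw [Nat.cast_succ] at hts ⊢
    rcases le_total t (s + n * ε) with hle | hle
    · refine (ih t ht hle).trans ?_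
      gcongr
      linarith
    · have hv := hgrid n t ht hle
      have hw := hsmall _ (hP _ hv) t (hP t ht) hle (by linarith)
      have n0 := hω.nonneg _ (hP _ hv) t (hP t ht) hle
      have h1 := ih _ hv le_rfl
      have h2 := hy _ hv t ht hle hw.le
      have h3 := hφ.dist_self_le _ (hP _ hv) t (hP t ht) hle hw.le (y (s + n * ε))
      have h4 : L * ω (s + n * ε) t ^ q ≤ L * h ^ q := by gcongr
      have h5 : K * ω (s + n * ε) t ^ ρ ≤ K * h ^ ρ := by gcongr
      have h6 := dist_triangle (y t) (φ t (s + n * ε) (y (s + n * ε))) (y s)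
      have h7 := dist_triangle (φ t (s + n * ε) (y (s + n * ε))) (y (s + n * ε)) (y s)
      linarith

/-- Each approximate-solution inequality involves two times only and is a closed condition. Finitely
many of them are met by a discrete solution, and compactness of a product of balls gives a path
meeting all of them. -/
theorem nonempty_approxSolSet [ProperSpace E] (hφ : IsLocalAlmostFlow 𝕋 ω h q ρ Λ A K φ)
    (hω : IsControl 𝕋 ω) (h𝕋 : 𝕋.OrdConnected) {s : ℝ} (hs : s ∈ 𝕋) (a : E) :
    (approxSolSet 𝕋 ω h q φ (sewingConst q Λ A) s a).Nonempty := by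
  classical
  set L := sewingConst q Λ A with hLdef
  have hL : 0 ≤ L := hφ.sewingConst_nonneg
  have hh0 := hφ.h_pos
  have hK := hφ.K_nonneg
  obtain ⟨ε, hε, hsmall⟩ := hω.small h hh0
  -- The radius counts grid steps of length `ε` from `s` to `t`, so it bounds all the discrete
  -- solutions at once.
  set B : ℝ → ℝ := fun t => (K * h ^ ρ + L * h ^ q) * ⌈(t - s) / ε⌉₊ with hB
  have hB0 : ∀ t, 0 ≤ B t := fun t => by positivity
  set Z : Set (ℝ → E) := (univ.pi fun t => Metric.closedBall a (B t)) ∩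
    ({y | y s = a} ∩ ⋂ t, ⋂ _ : t ∉ 𝕋 ∩ Ici s, {y | y t = a}) with hZ
  have hZc : IsCompact Z := (isCompact_univ_pi fun t => isCompact_closedBall a (B t)).inter_right
    ((isClosed_eq (continuous_apply s) continuous_const).inter (isClosed_iInter fun t =>
      isClosed_iInter fun _ => isClosed_eq (continuous_apply t) continuous_const))
  set T : ℝ × ℝ → Set (ℝ → E) := fun i => {y | i.1 ∈ 𝕋 → i.2 ∈ 𝕋 → s ≤ i.1 → i.1 ≤ i.2 →
    ω i.1 i.2 ≤ h → dist (y i.2) (φ i.2 i.1 (y i.1)) ≤ L * ω i.1 i.2 ^ q} with hT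
  have hTc : ∀ i, IsClosed (T i) := fun i => by
    simp only [hT, ofPred_forall]
    exact isClosed_iInter fun hu => isClosed_iInter fun ht => isClosed_iInter fun _ =>
      isClosed_iInter fun hut => isClosed_iInter fun hh => isClosed_le
        ((continuous_apply i.2).dist ((hφ.continuous hu ht hut hh).comp (continuous_apply i.1)))
        continuous_const
  have hfin : ∀ I : Finset (ℝ × ℝ), (Z ∩ ⋂ i ∈ I, T i).Nonempty := by
    intro I
    set P₀ : Finset ℝ := (I.image Prod.fst ∪ I.image Prod.snd).filter fun v => v ∈ 𝕋 ∧ s ≤ v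
      with hP₀
    obtain ⟨m, hm⟩ : ∃ m : ℕ, ∀ v ∈ P₀, v ≤ s + m * ε := by
      obtain ⟨b, hb⟩ := P₀.bddAbove
      obtain ⟨m, hm⟩ := exists_nat_ge ((b - s) / ε)
      refine ⟨m, fun v hv => (hb hv).trans ?_⟩
      rw [div_le_iff₀ hε] at hm
      linarith
    -- The grid is added to the times occurring in `I` because Davie's estimate only holds where the
    -- control is at most `h`; grid points let the displacement be summed over such intervals.
    set G : Finset ℝ := ((Finset.range (m + 1)).image fun k : ℕ => s + k * ε).filter
      fun v => v ∈ 𝕋 with hG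
    have hG0 : ∀ v ∈ G, v ∈ 𝕋 ∧ s ≤ v ∧ v ≤ s + m * ε := by
      intro v hv
      obtain ⟨hv, hv𝕋⟩ := Finset.mem_filter.1 hv
      obtain ⟨k, hk, rfl⟩ := Finset.mem_image.1 hv
      have hkm : (k : ℝ) ≤ m := by exact_mod_cast Nat.lt_succ_iff.1 (Finset.mem_range.1 hk)
      refine ⟨hv𝕋, ?_, ?_⟩
      · have : 0 ≤ k * ε := by positivity
        linarith
      · gcongr
    have hall : ∀ v ∈ P₀ ∪ G, v ∈ 𝕋 ∧ s ≤ v ∧ v ≤ s + m * ε := by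
      intro v hv
      rcases Finset.mem_union.1 hv with hv | hv
      · exact ⟨(Finset.mem_filter.1 hv).2.1, (Finset.mem_filter.1 hv).2.2, hm v hv⟩
      · exact hG0 v hv
    have hgrid : ∀ n : ℕ, ∀ t ∈ P₀ ∪ G, s + n * ε ≤ t → s + n * ε ∈ P₀ ∪ G := by
      intro n t ht hnt
      obtain ⟨ht1, -, ht3⟩ := hall t ht
      have hnm : n ≤ m := by
        have : (n : ℝ) * ε ≤ m * ε := by linarith
        exact_mod_cast le_of_mul_le_mul_right this hε
      have h0 : 0 ≤ n * ε := by positivity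
      exact Finset.mem_union_right _ (Finset.mem_filter.2 ⟨Finset.mem_image.2
        ⟨n, Finset.mem_range.2 (Nat.lt_succ_of_le hnm), rfl⟩,
        h𝕋.out hs ht1 ⟨by linarith, hnt⟩⟩)
    have hsP : s ∈ P₀ ∪ G := Finset.mem_union_right _ (Finset.mem_filter.2
      ⟨Finset.mem_image.2 ⟨0, Finset.mem_range.2 m.succ_pos, by simp⟩, hs⟩)
    obtain ⟨y, hys, hy⟩ := exists_discrete_path φ s a (P₀ ∪ G) hsP fun v hv => (hall v hv).2.1
    have hdis := hφ.discrete_estimate hω h𝕋 (fun v hv => (hall v hv).1) hy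
    have hbd := hφ.discrete_dist_le hω hsmall (fun v hv => (hall v hv).1) hL
      (fun v hv => (hall v hv).2.1) hgrid hdis
    -- The value off the finite set is immaterial to the constraints indexed by `I`; the value `a`
    -- keeps the path frozen outside `𝕋 ∩ Ici s` and inside the balls.
    refine ⟨fun t => if t ∈ P₀ ∪ G then y t else a, ⟨?_, ?_, ?_⟩, ?_⟩
    · intro t _
      rw [Metric.mem_closedBall]
      dsimp only
      split_ifs with ht
      · have := hbd ⌈(t - s) / ε⌉₊ t ht (by
          have := Nat.le_ceil ((t - s) / ε)
          rw [div_le_iff₀ hε] at this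
          linarith)
        rwa [hys] at this
      · rw [dist_self]
        exact hB0 t
    · simp only [mem_ofPred_eq, if_pos hsP, hys]
    · simp only [mem_iInter, mem_ofPred_eq]
      intro t ht
      rw [if_neg fun hmem => ht ⟨(hall t hmem).1, (hall t hmem).2.1⟩]
    · simp only [mem_iInter]
      intro i hi hu ht hsu hut hh
      have hu' : i.1 ∈ P₀ ∪ G := Finset.mem_union_left _ (Finset.mem_filter.2
        ⟨Finset.mem_union_left _ (Finset.mem_image_of_mem _ hi), hu, hsu⟩)
      have ht' : i.2 ∈ P₀ ∪ G := Finset.mem_union_left _ (Finset.mem_filter.2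
        ⟨Finset.mem_union_right _ (Finset.mem_image_of_mem _ hi), ht, hsu.trans hut⟩)
      simp only [if_pos hu', if_pos ht']
      exact hdis _ hu' _ ht' hut hh
  obtain ⟨y, ⟨-, hys, hyf⟩, hy⟩ := hZc.inter_iInter_nonempty T hTc hfin
  simp only [mem_iInter, mem_ofPred_eq] at hyf hy
  exact ⟨y, hys, hyf, fun u hu t ht hsu hut hh => hy (u, t) hu ht hsu hut hh⟩

end IsLocalAlmostFlow

/-! ### Selection of a measurable flow -/

theorem eq_of_dist_denseSeq_eq {E : Type*} [MetricSpace E] [TopologicalSpace.SeparableSpace E]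
    [Nonempty E] {x y : E}
    (hxy : ∀ k, dist x (TopologicalSpace.denseSeq E k) = dist y (TopologicalSpace.denseSeq E k)) :
    x = y := by
  have h : (fun z => dist x z) = fun z => dist y z :=
    Continuous.ext_on (TopologicalSpace.denseRange_denseSeq E) (by fun_prop) (by fun_prop)
      (forall_mem_range.2 hxy)
  have := congrFun h y
  simp only [dist_self] at this
  exact dist_eq_zero.1 this

/-- Two continuous paths on `𝕋 ∩ [s, ∞)` which start from the same point and agree at rational
times are equal there. -/
theorem eq_of_eq_rat {E : Type*} [MetricSpace E] {𝕋 : Set ℝ} (h𝕋 : 𝕋.OrdConnected) {s t : ℝ}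
    (hs : s ∈ 𝕋) (ht : t ∈ 𝕋) (hst : s ≤ t) {y z : ℝ → E} (hy : ContinuousOn y (𝕋 ∩ Ici s))
    (hz : ContinuousOn z (𝕋 ∩ Ici s)) (h0 : y s = z s) (hq : ∀ r : ℚ, y r = z r) :
    y t = z t := by
  rcases hst.eq_or_lt with rfl | hlt
  · exact h0
  by_contra hne
  have hd : ContinuousOn (fun v => dist (y v) (z v)) (𝕋 ∩ Ici s) :=
    continuous_dist.comp_continuousOn (hy.prodMk hz)
  obtain ⟨ε, hε, hball⟩ := Metric.continuousOn_iff.1 hd t ⟨ht, hst⟩ _ (dist_pos.2 hne)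
  obtain ⟨r, hr1, hr2⟩ := exists_rat_btwn (max_lt hlt (show t - ε < t by linarith))
  obtain ⟨hr3, hr4⟩ := max_lt_iff.1 hr1
  have := hball r ⟨h𝕋.out hs ht ⟨hr3.le, hr2.le⟩, hr3.le⟩ (by
    rw [Real.dist_eq, abs_lt]
    constructor <;> linarith)
  simp [hq r] at this

/-- A local almost flow on a proper metric space has a Borel measurable flow in its galaxy. -/
theorem IsLocalAlmostFlow.exists_measurable_flow {E : Type*} [MetricSpace E] [ProperSpace E]
    [MeasurableSpace E] [BorelSpace E] [Nonempty E] {𝕋 : Set ℝ} {ω : ℝ → ℝ → ℝ}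
    {h q ρ Λ A K : ℝ} {φ : ℝ → ℝ → E → E} (hφ : IsLocalAlmostFlow 𝕋 ω h q ρ Λ A K φ)
    (hω : IsControl 𝕋 ω) (h𝕋 : 𝕋.OrdConnected) :
    ∃ ψ : ℝ → ℝ → E → E, IsFlow 𝕋 ψ ∧
      (∀ s ∈ 𝕋, ∀ a, ContinuousOn (fun t => ψ t s a) (𝕋 ∩ Ici s)) ∧
      SameGalaxy 𝕋 ω (fun _ => 1) (fun δ => δ ^ q) φ ψ ∧
      (∀ s ∈ 𝕋, ∀ t ∈ 𝕋, s ≤ t → Measurable (ψ t s)) := by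
  classical
  set L := sewingConst q Λ A with hLdef
  have hL : 0 ≤ L := hφ.sewingConst_nonneg
  let e : ℕ ≃ ℚ × ℕ := (Denumerable.eqv (ℚ × ℕ)).symm
  let F : ℕ → (ℝ → E) → ℝ := fun n y =>
    dist (y ((e n).1 : ℝ)) (TopologicalSpace.denseSeq E (e n).2)
  have hF : ∀ n, Continuous (F n) := fun n => (continuous_apply _).dist continuous_const
  have hFrat : ∀ y z : ℝ → E, (∀ n, F n y = F n z) → ∀ r : ℚ, y r = z r := by
    intro y z hyz r
    refine eq_of_dist_denseSeq_eq fun k => ?_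
    have := hyz (e.symm (r, k))
    simpa only [F, Equiv.apply_symm_apply] using this
  have hsep : ∀ s ∈ 𝕋, ∀ a, ∀ y ∈ approxSolSet 𝕋 ω h q φ L s a,
      ∀ z ∈ approxSolSet 𝕋 ω h q φ L s a, (∀ n, F n y = F n z) → y = z := by
    intro s hs a y hy z hz hyz
    funext t
    by_cases ht : t ∈ 𝕋 ∩ Ici s
    · exact eq_of_eq_rat h𝕋 hs ht.1 ht.2 (hy.2.2.continuousOn hφ hω)
        (hz.2.2.continuousOn hφ hω) (hy.1.trans hz.1.symm) (hFrat y z hyz)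
    · rw [hy.2.1 t ht, hz.2.1 t ht]
  have hsel : ∀ s, ∃ σ : E → ℝ → E, s ∈ 𝕋 →
      (∀ a, σ a ∈ approxSolSet 𝕋 ω h q φ L s a) ∧
      (∀ C : Set (ℝ → E), IsClosed C → MeasurableSet {a | σ a ∈ C}) ∧
      ∀ a, ∀ y ∈ approxSolSet 𝕋 ω h q φ L s a, ∀ n,
        (∀ m < n, F m y = F m (σ a)) → F n (σ a) ≤ F n y := by
    intro s
    by_cases hs : s ∈ 𝕋
    · have hcomp : ∀ a, IsCompact (approxSolSet 𝕋 ω h q φ L s a) := fun a => by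
        rw [IsLocalAlmostFlow.approxSolSet_eq]
        exact hφ.isCompact_frozenSol hω h𝕋 hL hs a 0
      obtain ⟨σ, hσ⟩ := exists_measurable_lexMin hF (fun a => (hcomp a).isClosed) hcomp
        (fun a => hφ.nonempty_approxSolSet hω h𝕋 hs a)
        (fun C hC => hφ.measurableSet_hit hω h𝕋 hL hs C hC) (hsep s hs)
      exact ⟨σ, fun _ => hσ⟩
    · exact ⟨fun a _ => a, fun h => absurd h hs⟩
  choose σ hσ using hsel
  refine ⟨fun t s a => σ s a t, ⟨fun t ht a => ((hσ t ht).1 a).1, ?_⟩, ?_, ?_, ?_⟩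
  · intro r hr s hs t ht hrs hst a
    obtain ⟨hy1, hy2, hy3⟩ := (hσ r hr).1 a
    set y := σ r a with hy
    obtain ⟨hw1, hw2, hw3⟩ := (hσ s hs).1 (y s)
    -- Both `w`, selected from `y s`, and `z`, the restarted tail of `y`, are candidates at time
    -- `s`; `c` follows `y` and then `w`, and is a candidate against `y` at time `r`. The aim is `w
    -- = z`.
    set w := σ s (y s) with hw
    set z : ℝ → E := fun v => if v ∈ 𝕋 ∩ Ici s then y v else y s with hzdef
    have hz : ∀ v ∈ 𝕋, s ≤ v → z v = y v := fun v hv hsv => if_pos ⟨hv, hsv⟩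
    have hz' : ∀ v, v ∉ 𝕋 ∩ Ici s → z v = y s := fun v hv => if_neg hv
    have hzmem : z ∈ approxSolSet 𝕋 ω h q φ L s (y s) := by
      refine ⟨hz s hs le_rfl, hz', fun u hu v hv hsu huv hh => ?_⟩
      rw [hz u hu hsu, hz v hv (hsu.trans huv)]
      exact hy3 u hu v hv (hrs.trans hsu) huv hh
    set c : ℝ → E := fun v => if v ∈ 𝕋 ∩ Ici s then w v else y v with hcdef
    have hc : ∀ v ∈ 𝕋, s ≤ v → c v = w v := fun v hv hsv => if_pos ⟨hv, hsv⟩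
    have hc' : ∀ v, v ∉ 𝕋 ∩ Ici s → c v = y v := fun v hv => if_neg hv
    have hcs : ∀ v ∈ 𝕋, v ≤ s → c v = y v := fun v hv hvs => by
      rcases hvs.eq_or_lt with rfl | hlt
      · rw [hc v hv le_rfl, hw1]
      · exact hc' v fun hmem => hlt.not_ge hmem.2
    have hcmem : c ∈ approxSolSet 𝕋 ω h q φ L r a := by
      refine ⟨(hcs r hr hrs).trans hy1, fun v hv => ?_,
        IsApproxSol.concat hφ hω h𝕋 hs hy3 hw3 hw1 hcs hc⟩
      rw [hc' v fun hmem => hv ⟨hmem.1, hrs.trans hmem.2⟩, hy2 v hv]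
    -- If the first `n` criteria tie, minimality of `w` against `z` gives one inequality and
    -- minimality of `y` against `c` the other. Criteria at times outside `𝕋 ∩ Ici s` tie
    -- automatically: there `c = y`, while `w` and `z` are both frozen at `y s`.
    have hFeq : ∀ n, F n w = F n z := by
      intro n
      induction n using Nat.strong_induction_on with
      | _ n ih =>
        by_cases hv : ((e n).1 : ℝ) ∈ 𝕋 ∩ Ici s
        · refine le_antisymm ((hσ s hs).2.2 (y s) z hzmem n fun m hm => (ih m hm).symm) ?_
          have h1 := (hσ r hr).2.2 a c hcmem n fun m hm => by
            by_cases hvm : ((e m).1 : ℝ) ∈ 𝕋 ∩ Ici s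
            · have h2 := ih m hm
              simp only [F] at h2 ⊢
              rw [hc _ hvm.1 hvm.2, h2, hz _ hvm.1 hvm.2]
            · simp only [F]
              rw [hc' _ hvm]
          simp only [F] at h1 ⊢
          rw [hz _ hv.1 hv.2]
          rwa [hc _ hv.1 hv.2] at h1
        · simp only [F]
          rw [hw2 _ hv, hz' _ hv]
    have hwz : w = z := hsep s hs (y s) w ⟨hw1, hw2, hw3⟩ z hzmem hFeq
    change w t = y t
    rw [hwz, hz t ht hst]
  · exact fun s hs a => ((hσ s hs).1 a).2.2.continuousOn hφ hω
  · have hh0 := hφ.h_pos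
    have hK := hφ.K_nonneg
    have hq1 := hφ.one_le_q
    set M := K * h ^ ρ + L * h ^ q with hM
    have hM0 : 0 ≤ M := by positivity
    -- `L` serves where the control is at most `h`. Beyond, the displacements of `φ` and `ψ` are
    -- bounded separately: `K` handles the first, and the linear bound `M (1 + 4x)`, `x = ω / h ≥
    -- 1`, is at most `5 M x^q` since `q ≥ 1`.
    refine ⟨L + K + 5 * (M * (h ^ q)⁻¹), fun s hs t ht hst a => ?_⟩
    obtain ⟨hy1, hy2, hy3⟩ := (hσ s hs).1 a
    have n0 := hω.nonneg s hs t ht hst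
    have nq := Real.rpow_nonneg n0 q
    have hrest : 0 ≤ 5 * (M * (h ^ q)⁻¹) := by positivity
    rw [mul_one]
    rcases le_total (ω s t) h with hle | hle
    · have h1 := hy3 s hs t ht le_rfl hst hle
      rw [hy1, dist_comm] at h1
      refine h1.trans (mul_le_mul_of_nonneg_right ?_ nq)
      linarith
    · have h1 := hφ.dist_self_le_of_ge s hs t ht hst hle a
      have h2 := hy3.dist_le_linear hφ hω h𝕋 hL hs ht le_rfl hst
      rw [hy1, dist_comm] at h2
      have hx1 : 1 ≤ ω s t / h := (one_le_div hh0).2 hle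
      have hx : ω s t / h ≤ ω s t ^ q * (h ^ q)⁻¹ := by
        rw [← div_eq_mul_inv, ← Real.div_rpow n0 hh0.le]
        exact Real.self_le_rpow_of_one_le hx1 hq1
      have h3 : M * (1 + 4 * (ω s t / h)) ≤ M * (5 * (ω s t ^ q * (h ^ q)⁻¹)) := by
        gcongr
        linarith
      have h4 := dist_triangle (φ t s a) a (σ s a t)
      have h5 : 0 ≤ L * ω s t ^ q := by positivity
      have h6 : (L + K + 5 * (M * (h ^ q)⁻¹)) * ω s t ^ q =
          L * ω s t ^ q + K * ω s t ^ q + M * (5 * (ω s t ^ q * (h ^ q)⁻¹)) := by ring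
      linarith
  · intro s hs t _ _
    refine measurable_of_isClosed fun C hC => ?_
    exact (hσ s hs).2.1 _ (hC.preimage (continuous_apply t))

/-! ### Estimates on the Davie almost flow -/

section DavieEstimates

variable {U V : Type*} [NormedAddCommGroup U] [NormedSpace ℝ U]
  [NormedAddCommGroup V] [NormedSpace ℝ V]

/-- The linear map `u ⊗ v ↦ Q (P u) v`. -/
def tensorPairing (N : TensorNorm U) (P : U →L[ℝ] V) (Q : V →L[ℝ] (U →L[ℝ] V)) :
    N.Space →ₗ[ℝ] V :=
  (TensorProduct.lift
    ((ContinuousLinearMap.coeLM ℝ : (U →L[ℝ] V) →ₗ[ℝ] (U →ₗ[ℝ] V)).comp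
      (Q.comp P : U →ₗ[ℝ] (U →L[ℝ] V))) : U ⊗[ℝ] U →ₗ[ℝ] V)

theorem tensorPairing_sub (N : TensorNorm U) (P P' : U →L[ℝ] V)
    (Q Q' : V →L[ℝ] (U →L[ℝ] V)) :
    tensorPairing N P Q - tensorPairing N P' Q' =
      tensorPairing N (P - P') Q + tensorPairing N P' (Q - Q') := by
  refine TensorProduct.ext' fun u v => ?_
  change Q (P u) v - Q' (P' u) v = Q ((P - P') u) v + (Q - Q') (P' u) v
  simp

/-- Mean value inequality for `f` minus its linearization at `a`, on the ball of radius `‖b - a‖`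
around `a`. -/
theorem norm_taylor_le_of_fderiv_lipschitz {W : Type*} [NormedAddCommGroup W] [NormedSpace ℝ W] {f : V → W}
    (hf : Differentiable ℝ f) {M : ℝ} (hM : 0 ≤ M)
    (hlip : ∀ a b, ‖fderiv ℝ f a - fderiv ℝ f b‖ ≤ M * ‖a - b‖) (a b : V) :
    ‖f b - f a - fderiv ℝ f a (b - a)‖ ≤ M * ‖b - a‖ ^ 2 := by
  rw [pow_two, ← mul_assoc]
  refine (convex_closedBall a ‖b - a‖).norm_image_sub_le_of_norm_fderiv_le'
    (fun x _ => hf x) (fun x hx => (hlip x a).trans ?_)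
    (Metric.mem_closedBall_self (norm_nonneg _)) (by simp [dist_eq_norm])
  rw [Metric.mem_closedBall, dist_eq_norm] at hx
  gcongr

variable [FiniteDimensional ℝ V]

/-- In a basis of `V`, each coefficient of the pairing is a form `α ⊗ β` with `α` linear in `P` and
`β` linear in `Q`. The resulting constant is independent of `P` and `Q`, which makes the bounds on
`davieSecond` uniform in the base point. -/
theorem tensorPairing_bounded (N : TensorNorm U) :
    ∃ C : ℝ, 0 ≤ C ∧ ∀ (P : U →L[ℝ] V) (Q : V →L[ℝ] (U →L[ℝ] V)) (z : N.Space),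
      ‖tensorPairing N P Q z‖ ≤ C * ‖P‖ * ‖Q‖ * ‖z‖ := by
  obtain ⟨C, hC⟩ := N.dual_le
  let b := Module.finBasis ℝ V
  let c : Fin (Module.finrank ℝ V) → (V →L[ℝ] ℝ) := fun i =>
    LinearMap.toContinuousLinearMap (b.coord i)
  have hc : ∀ w : V, ∑ j, c j w • b j = w := fun w => b.sum_repr w
  have key : ∀ (P : U →L[ℝ] V) (Q : V →L[ℝ] (U →L[ℝ] V)) (z : U ⊗[ℝ] U),
      tensorPairing N P Q (show N.Space from z) =
      ∑ j, ∑ k, (LinearMap.mul' ℝ ℝ (TensorProduct.map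
        (((c k).comp P : U →L[ℝ] ℝ) : U →ₗ[ℝ] ℝ)
        (((c j).comp (Q (b k)) : U →L[ℝ] ℝ) : U →ₗ[ℝ] ℝ) z)) • b j := by
    intro P Q z
    have hlin : (show U ⊗[ℝ] U →ₗ[ℝ] V from tensorPairing N P Q) =
        ∑ j, ∑ k, (LinearMap.mul' ℝ ℝ ∘ₗ (TensorProduct.map
          (((c k).comp P : U →L[ℝ] ℝ) : U →ₗ[ℝ] ℝ)
          (((c j).comp (Q (b k)) : U →L[ℝ] ℝ) : U →ₗ[ℝ] ℝ))).smulRight (b j) := by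
      refine TensorProduct.ext' fun u v => ?_
      have h1 : Q (P u) v = ∑ k, c k (P u) • Q (b k) v := by
        conv_lhs => rw [← hc (P u)]
        simp
      change Q (P u) v = _
      rw [← hc (Q (P u) v), h1]
      simp [Finset.sum_smul]
    refine (LinearMap.congr_fun hlin z).trans ?_
    simp only [LinearMap.sum_apply, LinearMap.smulRight_apply, LinearMap.comp_apply]
  refine ⟨∑ j, ∑ k, |C| * ‖c k‖ * (‖c j‖ * ‖b k‖) * ‖b j‖, by positivity, fun P Q z => ?_⟩
  refine (congrArg norm (key P Q z)).le.trans ?_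
  refine (norm_sum_le _ _).trans ?_
  simp only [Finset.sum_mul]
  refine Finset.sum_le_sum fun j _ => (norm_sum_le _ _).trans (Finset.sum_le_sum fun k _ => ?_)
  rw [norm_smul, Real.norm_eq_abs]
  have hz : N.toSeminorm z = ‖z‖ := rfl
  have h := hC ((c k).comp P) ((c j).comp (Q (b k))) z
  rw [hz] at h
  have h1 : ‖(c k).comp P‖ ≤ ‖c k‖ * ‖P‖ := ContinuousLinearMap.opNorm_comp_le _ _
  have h2 : ‖(c j).comp (Q (b k))‖ ≤ ‖c j‖ * (‖Q‖ * ‖b k‖) :=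
    (ContinuousLinearMap.opNorm_comp_le _ _).trans (by gcongr; exact Q.le_opNorm _)
  calc _ ≤ (C * ‖(c k).comp P‖ * ‖(c j).comp (Q (b k))‖ * ‖z‖) * ‖b j‖ := by gcongr
    _ ≤ (|C| * (‖c k‖ * ‖P‖) * (‖c j‖ * (‖Q‖ * ‖b k‖)) * ‖z‖) * ‖b j‖ := by
        gcongr
        exact le_abs_self C
    _ = _ := by ring

theorem davieSecond_coe (N : TensorNorm U) (f : V → (U →L[ℝ] V)) (a : V) (z : N.Space) :
    davieSecond N f a (z : N.Completed) = tensorPairing N (f a) (fderiv ℝ f a) z := by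
  have := FiniteDimensional.complete ℝ V
  obtain ⟨C, hC⟩ := davieSecondAlg_bounded N f a
  refine LinearMap.extendOfNorm_eq (f := davieSecondAlg N f a)
    (e := (UniformSpace.Completion.toComplL (𝕜 := ℝ) (E := N.Space) : N.Space →ₗ[ℝ] N.Completed))
    UniformSpace.Completion.denseRange_coe ⟨C, fun z => (hC z).trans (le_of_eq ?_)⟩ z
  congr 1
  exact (UniformSpace.Completion.norm_coe z).symm

theorem norm_davieSecond_le (N : TensorNorm U) : ∃ C : ℝ, 0 ≤ C ∧
    (∀ (f : V → (U →L[ℝ] V)) (a : V) (z : N.Completed),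
      ‖davieSecond N f a z‖ ≤ C * ‖f a‖ * ‖fderiv ℝ f a‖ * ‖z‖) ∧
    ∀ (f : V → (U →L[ℝ] V)) (a b : V) (z : N.Completed),
      ‖davieSecond N f a z - davieSecond N f b z‖ ≤
        (C * ‖f a - f b‖ * ‖fderiv ℝ f a‖ + C * ‖f b‖ * ‖fderiv ℝ f a - fderiv ℝ f b‖) *
          ‖z‖ := by
  obtain ⟨C, hC0, hC⟩ := tensorPairing_bounded (V := V) N
  refine ⟨C, hC0, fun f a z => ?_, fun f a b z => ?_⟩
  · induction z using UniformSpace.Completion.induction_on with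
    | hp => exact isClosed_le (by fun_prop) (by fun_prop)
    | ih z =>
      rw [davieSecond_coe, UniformSpace.Completion.norm_coe]
      exact hC _ _ z
  · induction z using UniformSpace.Completion.induction_on with
    | hp => exact isClosed_le (by fun_prop) (by fun_prop)
    | ih z =>
      rw [davieSecond_coe, davieSecond_coe, UniformSpace.Completion.norm_coe,
        ← LinearMap.sub_apply, tensorPairing_sub, LinearMap.add_apply, add_mul]
      exact (norm_add_le _ _).trans (add_le_add (hC _ _ z) (hC _ _ z))

/-- Lipschitz continuity of `df(a)·f(a)` in `a` comes from the product rule for differences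
`tensorPairing_sub`, with both factors bounded and Lipschitz. -/
theorem exists_uniform_bound {f : V → (U →L[ℝ] V)} (hf : IsCbTwo f) (N : TensorNorm U) :
    ∃ M : ℝ, 0 ≤ M ∧ (∀ a, ‖f a‖ ≤ M) ∧ (∀ a, ‖fderiv ℝ f a‖ ≤ M) ∧
      (∀ a b, ‖f a - f b‖ ≤ M * ‖a - b‖) ∧
      (∀ a b, ‖f b - f a - fderiv ℝ f a (b - a)‖ ≤ M * ‖b - a‖ ^ 2) ∧
      (∀ a z, ‖davieSecond N f a z‖ ≤ M * ‖z‖) ∧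
      ∀ a b z, ‖davieSecond N f a z - davieSecond N f b z‖ ≤ M * ‖a - b‖ * ‖z‖ := by
  obtain ⟨B₀, h₀⟩ := hf.bounded
  obtain ⟨B₁, h₁⟩ := hf.fderiv_bounded
  obtain ⟨B₂, h₂⟩ := hf.fderiv_lipschitz
  obtain ⟨C, hC, hD, hD'⟩ := norm_davieSecond_le (V := V) N
  have hB₀ : 0 ≤ B₀ := (norm_nonneg _).trans (h₀ 0)
  have hB₁ : 0 ≤ B₁ := (norm_nonneg _).trans (h₁ 0)
  have h₂' : ∀ a b, ‖fderiv ℝ f a - fderiv ℝ f b‖ ≤ |B₂| * ‖a - b‖ := fun a b =>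
    (h₂ a b).trans (by gcongr; exact le_abs_self _)
  have hlip : ∀ a b, ‖f a - f b‖ ≤ B₁ * ‖a - b‖ := fun a b =>
    convex_univ.norm_image_sub_le_of_norm_fderiv_le (fun x _ => hf.differentiable x)
      (fun x _ => h₁ x) (mem_univ b) (mem_univ a)
  have e1 : 0 ≤ C * B₀ * B₁ := by positivity
  have e2 : 0 ≤ C * B₁ * B₁ + C * B₀ * |B₂| := by positivity
  have e3 := abs_nonneg B₂
  set M := B₀ + B₁ + |B₂| + C * B₀ * B₁ + (C * B₁ * B₁ + C * B₀ * |B₂|) with hM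
  refine ⟨M, by positivity, fun a => (h₀ a).trans (by linarith), fun a => (h₁ a).trans
    (by linarith), fun a b => (hlip a b).trans ?_, fun a b =>
    (norm_taylor_le_of_fderiv_lipschitz hf.differentiable (abs_nonneg B₂) h₂' a b).trans ?_, fun a z => ?_,
    fun a b z => ?_⟩
  · gcongr
    linarith
  · gcongr
    linarith
  · refine (hD f a z).trans ?_
    have : C * ‖f a‖ * ‖fderiv ℝ f a‖ ≤ C * B₀ * B₁ := by
      gcongr
      · exact h₀ a
      · exact h₁ a
    gcongr
    linarith
  · refine (hD' f a b z).trans ?_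
    gcongr
    calc C * ‖f a - f b‖ * ‖fderiv ℝ f a‖ + C * ‖f b‖ * ‖fderiv ℝ f a - fderiv ℝ f b‖
        ≤ C * (B₁ * ‖a - b‖) * B₁ + C * B₀ * (|B₂| * ‖a - b‖) := by
          gcongr
          · exact hlip a b
          · exact h₁ a
          · exact h₀ b
          · exact h₂' a b
      _ = (C * B₁ * B₁ + C * B₀ * |B₂|) * ‖a - b‖ := by ring
      _ ≤ M * ‖a - b‖ := by
          gcongr
          linarith

/-- Chen's relation turns the defect of the flow property into three terms of order `3/p`. -/
theorem davieFlow_comp_sub (N : TensorNorm U) (f : V → (U →L[ℝ] V)) {x1 : ℝ → ℝ → U}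
    {x2 : ℝ → ℝ → N.Completed} {r s t : ℝ} (h1 : x1 r t = x1 r s + x1 s t)
    (h2 : x2 r t = x2 r s + x2 s t + N.tmul (x1 r s) (x1 s t)) {a b : V}
    (hb : b = davieFlow N f x1 x2 s r a) :
    davieFlow N f x1 x2 t s b - davieFlow N f x1 x2 t r a =
      (f b - f a - fderiv ℝ f a (b - a)) (x1 s t) +
        fderiv ℝ f a (davieSecond N f a (x2 r s)) (x1 s t) +
        (davieSecond N f b (x2 s t) - davieSecond N f a (x2 s t)) := by
  have hba : b - a = f a (x1 r s) + davieSecond N f a (x2 r s) := by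
    rw [hb, davieFlow]
    abel
  have hb' : b = a + f a (x1 r s) + davieSecond N f a (x2 r s) := hb
  rw [hba, davieFlow, davieFlow, h1, h2]
  simp only [map_add, davieSecond_tmul, sub_apply, add_apply]
  nth_rewrite 1 [hb']
  abel

/-- The Davie almost flow is a local almost flow, with exponent `3/p`. -/
theorem exists_isLocalAlmostFlow_davieFlow (N : TensorNorm U) {𝕋 : Set ℝ}
    {ω : ℝ → ℝ → ℝ} (hω : IsControl 𝕋 ω) (h𝕋 : 𝕋.OrdConnected) {p : ℝ} (hp0 : 0 < p)
    (hp3 : p < 3) {x1 : ℝ → ℝ → U} {x2 : ℝ → ℝ → N.Completed}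
    (hx : IsRoughPath N 𝕋 ω p x1 x2) {f : V → (U →L[ℝ] V)} (hf : IsCbTwo f) :
    ∃ h Λ A K : ℝ,
      IsLocalAlmostFlow 𝕋 ω h (3 / p) (1 / p) Λ A K (davieFlow N f x1 x2) := by
  obtain ⟨M₀, hM₀, b1, b2, b3, b4, b5, b6⟩ := exists_uniform_bound hf N
  obtain ⟨C₁, hC₁⟩ := hx.var1
  obtain ⟨C₂, hC₂⟩ := hx.var2
  set M := M₀ + |C₁| + |C₂| with hMdef
  have hc1 := abs_nonneg C₁
  have hc2 := abs_nonneg C₂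
  have hM : 0 ≤ M := by positivity
  have hMM : M₀ ≤ M := by linarith
  replace b1 := fun a => (b1 a).trans hMM
  replace b2 := fun a => (b2 a).trans hMM
  replace b3 : ∀ a b, ‖f a - f b‖ ≤ M * ‖a - b‖ := fun a b => (b3 a b).trans (by gcongr)
  replace b4 : ∀ a b, ‖f b - f a - fderiv ℝ f a (b - a)‖ ≤ M * ‖b - a‖ ^ 2 :=
    fun a b => (b4 a b).trans (by gcongr)
  replace b5 : ∀ a z, ‖davieSecond N f a z‖ ≤ M * ‖z‖ := fun a z => (b5 a z).trans (by gcongr)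
  replace b6 : ∀ a b z, ‖davieSecond N f a z - davieSecond N f b z‖ ≤ M * ‖a - b‖ * ‖z‖ :=
    fun a b z => (b6 a b z).trans (by gcongr)
  -- In the variable `X = ω^(1/p)`, the exponents `2/p` and `3/p` become integer powers.
  have hpow : ∀ x : ℝ, 0 ≤ x → ∀ n : ℕ, x ^ ((n : ℝ) / p) = (x ^ (1 / p)) ^ n := by
    intro x hx n
    rw [← Real.rpow_natCast, ← Real.rpow_mul hx]
    congr 1
    ring
  have v1 : ∀ s ∈ 𝕋, ∀ t ∈ 𝕋, s ≤ t → ‖x1 s t‖ ≤ M * ω s t ^ (1 / p) := by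
    intro s hs t ht hst
    have := Real.rpow_nonneg (hω.nonneg s hs t ht hst) (1 / p)
    refine (hC₁ s hs t ht hst).trans ?_
    gcongr
    linarith [le_abs_self C₁]
  have v2 : ∀ s ∈ 𝕋, ∀ t ∈ 𝕋, s ≤ t → ‖x2 s t‖ ≤ M * (ω s t ^ (1 / p)) ^ 2 := by
    intro s hs t ht hst
    have n0 := hω.nonneg s hs t ht hst
    have h1 := hC₂ s hs t ht hst
    have h2 := hpow _ n0 2
    rw [Nat.cast_ofNat] at h2
    rw [h2] at h1
    refine h1.trans ?_
    gcongr
    linarith [le_abs_self C₂]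
  have hρ : 0 < 1 / p := by positivity
  have hq : 1 < 3 / p := (one_lt_div hp0).2 hp3
  -- At `h = 0` the factor is `2 * (1/2)^(3/p)`, below `1` because `p < 3`; continuity gives a
  -- positive `h`.
  obtain ⟨h, hh0, hh1, hcontr⟩ : ∃ h : ℝ, 0 < h ∧ h ≤ 1 ∧
      (1 + (1 + 2 * M ^ 2 * h ^ (1 / p)) ^ 2) * (1 / 2) ^ (3 / p) < 1 := by
    have hcont : ContinuousAt
        (fun x : ℝ => (1 + (1 + 2 * M ^ 2 * x ^ (1 / p)) ^ 2) * (1 / 2 : ℝ) ^ (3 / p)) 0 := by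
      have := Real.continuousAt_rpow_const 0 (1 / p) (Or.inr hρ.le)
      fun_prop
    have hlt : (1 + (1 + 2 * M ^ 2 * (0 : ℝ) ^ (1 / p)) ^ 2) * (1 / 2 : ℝ) ^ (3 / p) < 1 := by
      rw [Real.zero_rpow hρ.ne']
      have := Real.rpow_lt_rpow_of_exponent_gt (x := 1 / 2) (by norm_num) (by norm_num) hq
      rw [Real.rpow_one] at this
      norm_num at this ⊢
      linarith
    obtain ⟨η, hη, hηlt⟩ := Metric.eventually_nhds_iff.1 (hcont.eventually_lt_const hlt)
    have hmin : 0 < min 1 (η / 2) := lt_min one_pos (by positivity)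
    refine ⟨min 1 (η / 2), hmin, min_le_left _ _, hηlt ?_⟩
    rw [Real.dist_eq, sub_zero, abs_of_pos hmin]
    linarith [min_le_right 1 (η / 2)]
  set H := h ^ (1 / p) with hH
  have hH0 : 0 < H := Real.rpow_pos_of_pos hh0 _
  have hH1 : H ≤ 1 := Real.rpow_le_one hh0.le hh1 hρ.le
  have hmono : ∀ x, 0 ≤ x → x ≤ h → x ^ (1 / p) ≤ H := fun x hx hxh =>
    Real.rpow_le_rpow hx hxh hρ.le
  have move : ∀ s ∈ 𝕋, ∀ t ∈ 𝕋, s ≤ t → ∀ a, ‖davieFlow N f x1 x2 t s a - a‖ ≤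
      M ^ 2 * (ω s t ^ (1 / p) + (ω s t ^ (1 / p)) ^ 2) := by
    intro s hs t ht hst a
    have h1 : ‖f a (x1 s t)‖ ≤ M * (M * ω s t ^ (1 / p)) :=
      (f a).le_of_opNorm_le_of_le (b1 a) (v1 s hs t ht hst)
    have h2 : ‖davieSecond N f a (x2 s t)‖ ≤ M * (M * (ω s t ^ (1 / p)) ^ 2) :=
      (b5 a _).trans (by gcongr; exact v2 s hs t ht hst)
    have h3 : davieFlow N f x1 x2 t s a - a = f a (x1 s t) + davieSecond N f a (x2 s t) := by
      rw [davieFlow]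
      abel
    rw [h3]
    refine (norm_add_le _ _).trans ((add_le_add h1 h2).trans (le_of_eq ?_))
    ring
  have small : ∀ s ∈ 𝕋, ∀ t ∈ 𝕋, s ≤ t → ω s t ≤ h → ∀ a,
      ‖davieFlow N f x1 x2 t s a - a‖ ≤ 2 * M ^ 2 * ω s t ^ (1 / p) := by
    intro s hs t ht hst hh a
    have n0 := hω.nonneg s hs t ht hst
    have hX0 := Real.rpow_nonneg n0 (1 / p)
    have hX1 := (hmono _ n0 hh).trans hH1
    refine (move s hs t ht hst a).trans ?_
    have : (ω s t ^ (1 / p)) ^ 2 ≤ ω s t ^ (1 / p) := pow_le_of_le_one hX0 hX1 two_ne_zero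
    calc M ^ 2 * (ω s t ^ (1 / p) + (ω s t ^ (1 / p)) ^ 2)
        ≤ M ^ 2 * (ω s t ^ (1 / p) + ω s t ^ (1 / p)) := by gcongr
      _ = _ := by ring
  have hcube : ∀ x : ℝ, 0 ≤ x → x ^ (3 / p) = (x ^ (1 / p)) ^ 3 := fun x hx => by
    have := hpow x hx 3
    rwa [Nat.cast_ofNat] at this
  have hHinv : 1 ≤ (H ^ 2)⁻¹ := (one_le_inv₀ (by positivity)).2 (pow_le_one₀ hH0.le hH1)
  -- The Taylor term contributes `4 M⁶` to the defect, the two second-level terms `M⁴` and `2 M⁴`.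
  -- The factor `(H ^ 2)⁻¹` in the displacement constant pays for bounding `X` and `X²` by a
  -- multiple of `X³` when `X ≥ H`.
  refine ⟨h, 1 + 2 * M ^ 2 * H, 4 * M ^ 6 + 3 * M ^ 4, 2 * M ^ 2 * (H ^ 2)⁻¹,
    hh0, hq.le, hρ, by positivity, by positivity, by positivity, hcontr, ?_, ?_, ?_, ?_⟩
  · intro s hs t ht hst hh a b
    have n0 := hω.nonneg s hs t ht hst
    have hX0 := Real.rpow_nonneg n0 (1 / p)
    have hXH := hmono _ n0 hh
    have hX2 : (ω s t ^ (1 / p)) ^ 2 ≤ H :=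
      (pow_le_of_le_one hX0 (hXH.trans hH1) two_ne_zero).trans hXH
    have h1 : ‖(f a - f b) (x1 s t)‖ ≤ (M * ‖a - b‖) * (M * H) :=
      (f a - f b).le_of_opNorm_le_of_le (b3 a b)
        ((v1 s hs t ht hst).trans (by gcongr))
    have h2 : ‖davieSecond N f a (x2 s t) - davieSecond N f b (x2 s t)‖ ≤
        M * ‖a - b‖ * (M * H) :=
      (b6 a b _).trans (by gcongr; exact (v2 s hs t ht hst).trans (by gcongr))
    rw [dist_eq_norm, dist_eq_norm]
    have h3 : davieFlow N f x1 x2 t s a - davieFlow N f x1 x2 t s b = (a - b) +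
        (f a - f b) (x1 s t) + (davieSecond N f a (x2 s t) - davieSecond N f b (x2 s t)) := by
      rw [davieFlow, davieFlow, sub_apply]
      abel
    rw [h3]
    refine norm_add₃_le.trans ((add_le_add (add_le_add le_rfl h1) h2).trans (le_of_eq ?_))
    ring
  · intro r hr s hs t ht hrs hst hh a
    have hrt := hrs.trans hst
    have n0 := hω.nonneg r hr t ht hrt
    have w1 := hω.le_of_subinterval h𝕋 hr ht le_rfl hrs hst
    have w2 := hω.le_of_subinterval h𝕋 hr ht hrs hst le_rfl
    have m1 := hω.nonneg r hr s hs hrs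
    have m2 := hω.nonneg s hs t ht hst
    have x1' := Real.rpow_nonneg m1 (1 / p)
    have x2' := Real.rpow_nonneg m2 (1 / p)
    have y1 := Real.rpow_le_rpow m1 w1 hρ.le
    have y2 := Real.rpow_le_rpow m2 w2 hρ.le
    have hX0 := Real.rpow_nonneg n0 (1 / p)
    rw [hcube _ n0, dist_eq_norm, davieFlow_comp_sub N f (hx.chen1 r hr s hs t ht hrs hst)
      (hx.chen2 r hr s hs t ht hrs hst) rfl]
    set X := ω r t ^ (1 / p) with hX
    set b := davieFlow N f x1 x2 s r a with hb
    have hba : ‖b - a‖ ≤ 2 * M ^ 2 * X :=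
      (small r hr s hs hrs (w1.trans hh) a).trans (by gcongr)
    have hx1 : ‖x1 s t‖ ≤ M * X := (v1 s hs t ht hst).trans (by gcongr)
    have hx2 : ‖x2 s t‖ ≤ M * X ^ 2 := (v2 s hs t ht hst).trans (by gcongr)
    have hx2' : ‖x2 r s‖ ≤ M * X ^ 2 := (v2 r hr s hs hrs).trans (by gcongr)
    have t1 : ‖(f b - f a - fderiv ℝ f a (b - a)) (x1 s t)‖ ≤
        (M * (2 * M ^ 2 * X) ^ 2) * (M * X) :=
      ContinuousLinearMap.le_of_opNorm_le_of_le _ ((b4 a b).trans (by gcongr)) hx1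
    have t2 : ‖fderiv ℝ f a (davieSecond N f a (x2 r s)) (x1 s t)‖ ≤
        (M * (M * (M * X ^ 2))) * (M * X) :=
      ContinuousLinearMap.le_of_opNorm_le_of_le _
        (ContinuousLinearMap.le_of_opNorm_le_of_le _ (b2 a) ((b5 a _).trans (by gcongr))) hx1
    have t3 : ‖davieSecond N f b (x2 s t) - davieSecond N f a (x2 s t)‖ ≤
        M * (2 * M ^ 2 * X) * (M * X ^ 2) := (b6 b a _).trans (by gcongr)
    refine norm_add₃_le.trans ((add_le_add (add_le_add t1 t2) t3).trans (le_of_eq ?_))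
    ring
  · intro s hs t ht hst hh a
    have hX0 := Real.rpow_nonneg (hω.nonneg s hs t ht hst) (1 / p)
    rw [dist_eq_norm]
    exact (small s hs t ht hst hh a).trans (mul_le_mul_of_nonneg_right
      (le_mul_of_one_le_right (by positivity) hHinv) hX0)
  · intro s hs t ht hst hh a
    have n0 := hω.nonneg s hs t ht hst
    have hX : H ≤ ω s t ^ (1 / p) := Real.rpow_le_rpow hh0.le hh hρ.le
    rw [dist_eq_norm, hcube _ n0]
    refine (move s hs t ht hst a).trans ?_
    set X := ω s t ^ (1 / p) with hXdef
    have hX0 : 0 < X := hH0.trans_le hX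
    have hX2 : H ^ 2 ≤ X := (pow_le_of_le_one hH0.le hH1 two_ne_zero).trans hX
    have e1 : X ≤ X ^ 3 * (H ^ 2)⁻¹ := by
      rw [← div_eq_mul_inv, le_div_iff₀ (by positivity)]
      calc X * H ^ 2 ≤ X * X ^ 2 := by gcongr
        _ = X ^ 3 := by ring
    have e2 : X ^ 2 ≤ X ^ 3 * (H ^ 2)⁻¹ := by
      rw [← div_eq_mul_inv, le_div_iff₀ (by positivity)]
      calc X ^ 2 * H ^ 2 ≤ X ^ 2 * X := by gcongr
        _ = X ^ 3 := by ring
    calc M ^ 2 * (X + X ^ 2) ≤ M ^ 2 * (X ^ 3 * (H ^ 2)⁻¹ + X ^ 3 * (H ^ 2)⁻¹) := by gcongr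
      _ = 2 * M ^ 2 * (H ^ 2)⁻¹ * X ^ 3 := by ring

end DavieEstimates

theorem IsTimeSet.ordConnected {𝕋 : Set ℝ} (h : IsTimeSet 𝕋) : 𝕋.OrdConnected := by
  rcases h with ⟨T, _, rfl⟩ | rfl
  · exact ordConnected_Icc
  · exact ordConnected_Ici

end

theorem corollary10
    {U V : Type*} [NormedAddCommGroup U] [NormedSpace ℝ U] [CompleteSpace U]
    [NormedAddCommGroup V] [NormedSpace ℝ V] [FiniteDimensional ℝ V]
    [MeasurableSpace V] [BorelSpace V]
    (N : TensorNorm U)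
    (𝕋 : Set ℝ) (h𝕋 : IsTimeSet 𝕋)
    (ω : ℝ → ℝ → ℝ) (hω : IsControl 𝕋 ω)
    (p : ℝ) (hp2 : 2 ≤ p) (hp3 : p < 3)
    (x1 : ℝ → ℝ → U) (x2 : ℝ → ℝ → N.Completed) (hx : IsRoughPath N 𝕋 ω p x1 x2)
    (f : V → (U →L[ℝ] V)) (hf : IsCbTwo f) :
    ∃ ψ : ℝ → ℝ → V → V,
      IsFlow 𝕋 ψ ∧
      (∀ s ∈ 𝕋, ∀ a, ContinuousOn (fun t => ψ t s a) (𝕋 ∩ Set.Ici s)) ∧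
      SameGalaxy 𝕋 ω (fun _ => 1) (fun δ => δ ^ (3 / p)) (davieFlow N f x1 x2) ψ ∧
      (∀ s ∈ 𝕋, ∀ t ∈ 𝕋, s ≤ t → Measurable (ψ t s)) := by
  have h := h𝕋.ordConnected
  have := FiniteDimensional.proper ℝ V
  obtain ⟨_, _, _, _, hφ⟩ := exists_isLocalAlmostFlow_davieFlow N hω h
    (zero_lt_two.trans_le hp2) hp3 hx hf
  exact hφ.exists_measurable_flow hω h
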